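/- **Setting.** Let $\mathcal X$ be a measurable space, $\mathcal F$ a class of measurable classifiers $\mathcal X\to\{0,1\}$ of VC dimension $d$ (with the usual measurability: for all $n$ and $y\in\{0,1\}^n$ the set of $(x_1,\dots,x_n)$ such that some $f\in\mathcal F$ has $f(x_j)=y_j$ for all $j$ is measurable up to null sets of every product $P^{n}$ of a probability measure $P$ on $\mathcal X$). Let $D_1,\dots,D_k$, $k\ge 2$, be probability distributions on $\mathcal X\times\{0,1\}$. Write $\mathrm{err}_D(f)=\Pr_{(x,y)\sim D}[f(x)\ne y]$, let $\mathrm{err}_S(f)$ be the fraction of the sample $S$ that $f$ mislabels, and let $\mathrm{OPT}=\inf_{f\in\mathcal F}\max_{i\in[k]}\mathrm{err}_{D_i}(f)$. For $\epsilon,\delta,\alpha\in(0,1)$ put $\alpha'=\alpha/12$, $\epsilon'=\epsilon/25$, $t=2\lceil \ln k/(\epsilon'\alpha'^2)\rceil$, $\delta'=\delta/(4t)$. Let $\mathcal O$ be an oracle that maps a sample $S$ to some $\mathcal O(S)\in\mathcal F$ with $\mathrm{err}_S(\mathcal O(S))\le\inf_{f\in\mathcal F}\mathrm{err}_S(f)+\epsilon'$,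 where $(S,x)\mapsto\mathcal O(S)(x)$ is measurable. **Algorithm NR1-AVG** with sample sizes $n_S,n_T$. Start with $w^{(0)}_i=1$ for $i\in[k]$. In round $r=1,\dots,t$: draw $n_S$ i.i.d. samples $S^{(r)}$ from the mixture $\sum_i w_i^{(r-1)}D_i\big/\sum_i w_i^{(r-1)}$; let $f^{(r)}=\mathcal O(S^{(r)})$; for each $i$ draw $n_T$ fresh i.i.d. samples $T_i$ from $D_i$, put $s_i^{(r)}=\dfrac{\mathrm{err}_{T_i}(f^{(r)})\,\epsilon'\alpha'}{(1+3\alpha')\,\mathrm{err}_{S^{(r)}}(f^{(r)})+3\epsilon'}$ and $w_i^{(r)}=w_i^{(r-1)}(1+s_i^{(r)})$. Return the randomized classifier $\hat f$ that, given $x$, picks $r\in[t]$ uniformly at random and answers $f^{(r)}(x)$. Its expected error $\overline{\mathrm{err}}_{D}(\hat f)$ is the probability, over $(x,y)\sim D$ and the choice of $r$, that the answer differs from $y$. The algorithm uses $m=t(n_S+k\,n_T)$ samples. **Theorem.** There are sample sizes $n_S=n_S(k,d,\epsilon,\delta,\alpha)$ and $n_T=n_T(k,\epsilon,\delta,\alpha)$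 with $$n_S=O\Big(\frac1{\alpha'\epsilon'}\Big(d\ln\frac1{\epsilon'}+\ln\frac1{\delta'}\Big)\Big),\qquad n_T=O\Big(\frac1{\alpha'\epsilon'}\ln\frac k{\delta'}\Big)$$ such that for all $k\ge2$, $d\ge 0$, $\epsilon,\delta\in(0,1)$ and $24\epsilon/25<\alpha<1$ and all $\mathcal X,\mathcal F,D_1,\dots,D_k,\mathcal O$ as above, Algorithm NR1-AVG with these (or any larger) sample sizes returns, with probability at least $1-\delta$, a randomized classifier $\hat f$ with $$\overline{\mathrm{err}}_{D_i}(\hat f)\le(1+\alpha)\,\mathrm{OPT}+\epsilon\quad\text{for all } i\in[k],$$ and with the sizes $n_S,n_T$ it uses $$m=O\Big(\frac{\ln k}{\alpha^3\epsilon^2}\Big(d\,\max\{1,\ln(1/\epsilon)\}+k\ln\frac k\delta\Big)\Big)$$ samples. All constants in the $O$'s are absolute. -/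

import Mathlib

open MeasureTheory ProbabilityTheory

namespace CollabPAC

noncomputable section

section Model

variable {X : Type*}

/-- The error `Pr_{(x,y) ~ D} [f x ≠ y]` of a classifier. -/
def err [MeasurableSpace X] (D : Measure (X × Bool)) (f : X → Bool) : ℝ :=
  D.real {z | f z.1 ≠ z.2}

/-- The fraction of the sample `S` that `f` mislabels. -/
def empErr {n : ℕ} (S : Fin n → X × Bool) (f : X → Bool) : ℝ :=
  ((Finset.univ.filter fun j => f (S j).1 ≠ (S j).2).card : ℝ) / n

/-- `OPT = inf_{f ∈ F} max_i err_{D_i} f`. -/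
def opt [MeasurableSpace X] {k : ℕ} (D : Fin k → Measure (X × Bool)) (F : Set (X → Bool)) : ℝ :=
  ⨅ f : F, ⨆ i, err (D i) f

/-- Every labelling of the finite set `A` is realised by a member of `F`. -/
def Shatters (F : Set (X → Bool)) (A : Finset X) : Prop :=
  ∀ g : X → Bool, ∃ f ∈ F, ∀ x ∈ A, f x = g x

/-- `F` has (finite) VC dimension `d`: the largest size of a shattered set is `d`. -/
def HasVCDim (F : Set (X → Bool)) (d : ℕ) : Prop :=
  IsGreatest {n : ℕ | ∃ A : Finset X, A.card = n ∧ Shatters F A} d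

/-- The tacit measurability assumption of VC theory: the members of `F` are measurable, and the
set of `n`-point samples on which a given labelling is realised by a member of `F` is measurable
up to null sets, for every i.i.d. law of the sample. -/
structure IsMeasurableClass [MeasurableSpace X] (F : Set (X → Bool)) : Prop where
  measurable_of_mem : ∀ f ∈ F, Measurable f
  trace : ∀ (n : ℕ) (y : Fin n → Bool) (P : Measure X), IsProbabilityMeasure P →
    NullMeasurableSet {x : Fin n → X | ∃ f ∈ F, ∀ j, f (x j) = y j} (Measure.pi fun _ => P)

/-- `O` is an (approximate) empirical risk minimiser for `F` on samples of size `n`: it returns a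
member of `F` whose empirical error is within `η` of the infimum over `F`. The label that the
returned hypothesis gives to a point is a measurable function of the sample and the point. -/
structure IsERM [MeasurableSpace X] (F : Set (X → Bool)) (η : ℝ) {n : ℕ}
    (O : (Fin n → X × Bool) → X → Bool) : Prop where
  measurable : Measurable fun p : (Fin n → X × Bool) × X => O p.1 p.2
  mem : ∀ S, O S ∈ F
  empErr_le : ∀ S, empErr S (O S) ≤ (⨅ f : F, empErr S f) + η

/-- The randomized classifier that, given `x`, picks one of `f 0, …, f (t - 1)` uniformly at
random and returns its label of `x`: the law of the returned label. -/
def uniformClassifier {t : ℕ} (f : Fin t → X → Bool) (x : X) : Measure Bool :=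
  (uniformOn (Set.univ : Set (Fin t))).map fun r => f r x

/-- The probability, over the example and the classifier's randomness, that a randomized
classifier mislabels the example. -/
def expErr [MeasurableSpace X] (D : Measure (X × Bool)) (g : X → Measure Bool) : ℝ :=
  ∫ z, (g z.1).real {b | b ≠ z.2} ∂D

end Model

section Parameters

/-- `α' = α / 12`. -/
def alpha' (α : ℝ) : ℝ := α / 12

/-- `ε' = ε / 25`. -/
def eps' (ε : ℝ) : ℝ := ε / 25

/-- The number of rounds `t = 2 ⌈ln k / (ε' α'²)⌉`. -/
def rounds (k : ℕ) (ε α : ℝ) : ℕ := 2 * ⌈Real.log k / (eps' ε * alpha' α ^ 2)⌉₊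

/-- `δ' = δ / (4 t)`. -/
def delta' (k : ℕ) (ε δ α : ℝ) : ℝ := δ / (4 * rounds k ε α)

/-- The number of samples drawn in all rounds, when every round draws `mS` samples from the
mixture and `mT` samples from each of the `k` players. -/
def sampleCount (k : ℕ) (ε α : ℝ) (mS mT : ℕ) : ℕ := rounds k ε α * (mS + k * mT)

end Parameters

section Algorithm

/-- The samples of one round: `S` from the mixture, and `T i` from each player `i`. -/
abbrev Round (X : Type*) (k mS mT : ℕ) : Type _ :=
  (Fin mS → X × Bool) × (Fin k → Fin mT → X × Bool)

variable {X : Type*} {k mS mT : ℕ}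

/-- The step `s_i` of a round, for the classifier `O S` of that round. -/
def step (ε α : ℝ) (O : (Fin mS → X × Bool) → X → Bool) (z : Round X k mS mT) (i : Fin k) : ℝ :=
  empErr (z.2 i) (O z.1) * eps' ε * alpha' α /
    ((1 + 3 * alpha' α) * empErr z.1 (O z.1) + 3 * eps' ε)

/-- The weights `w_i` after `r` rounds with samples `h`. -/
def weights (ε α : ℝ) (O : (Fin mS → X × Bool) → X → Bool) :
    (r : ℕ) → (Fin r → Round X k mS mT) → Fin k → ℝ
  | 0, _, _ => 1
  | r + 1, h, i =>
      weights ε α O r (fun j => h j.castSucc) i * (1 + step ε α O (h (Fin.last r)) i)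

/-- The randomized classifier that the algorithm returns after `t` rounds with samples `h`; the
classifier of round `r` is `O S` for the sample `S = (h r).1` of that round. -/
def output (O : (Fin mS → X × Bool) → X → Bool) {t : ℕ} (h : Fin t → Round X k mS mT) :
    X → Measure Bool :=
  uniformClassifier fun r => O (h r).1

variable [MeasurableSpace X]

/-- The mixture `(1/Φ) ∑ w_i D_i`, where `Φ = ∑ w_i`. -/
def mixture (D : Fin k → Measure (X × Bool)) (w : Fin k → ℝ) : Measure (X × Bool) :=
  ∑ i, ENNReal.ofReal (w i / ∑ j, w j) • D i

/-- The law of the samples of one round, given the current weights: `mS` i.i.d. samples from the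
mixture and, independently, `mT` i.i.d. samples from each `D i`. -/
def roundLaw (D : Fin k → Measure (X × Bool)) (w : Fin k → ℝ) : Measure (Round X k mS mT) :=
  (Measure.pi fun _ : Fin mS => mixture D w).prod
    (Measure.pi fun i => Measure.pi fun _ : Fin mT => D i)

/-- The joint law of the samples of the first `r` rounds of the algorithm. -/
def law (ε α : ℝ) (D : Fin k → Measure (X × Bool)) (O : (Fin mS → X × Bool) → X → Bool) :
    (r : ℕ) → Measure (Fin r → Round X k mS mT)
  | 0 => Measure.dirac Fin.elim0
  | r + 1 => (law ε α D O r).bind fun h =>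
      (roundLaw D (weights ε α O r h)).map fun z => Fin.snoc (α := fun _ => Round X k mS mT) h z

end Algorithm

end

end CollabPAC

/-! The argument is a multiplicative-weights scheme analysed by one exponential supermartingale per
player. Write `a` and `e` for the rescaled parameters `alpha' α` and `eps' ε`, `f` for the
classifier of a round, `p` for the normalized weights, and `q = (1 + 3a) * empErr S f + 3e` for the
denominator of the steps.

A round is good if the mixture error of `f` is at most `(1 + a) * empErr S f + e` and `empErr S f`
is at most about `(1 + a) * OPT`, up to a multiple of `e`. The first condition is a relative uniform
deviation bound (`measure_overfit_le`), proved by symmetrization with an exponential moment and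
Sauer–Shelah. The second compares the oracle with one fixed near-optimal classifier through a
Chernoff bound. A union bound makes all `t` rounds good up to probability `δ/2`.

For player `i` the potential is `log Φ - log w_i`, with `Φ` the sum of the weights, plus `e * a *
((1 - a/3) * ∑ err_i(f)/q - r)`. In one round `log Φ` grows by at most the `p`-average of the steps,
while `log w_i` grows by at least `(1 - a/6) * s_i`. In expectation over the players' samples the
normalized change is at most `mixErr/q - (a/6) * err_i/q - 1`. Goodness gives `(1 + a/6) * mixErr ≤
q`, so the drift is negative by just enough to pay for the second-order terms of the exponential
moment. Hence `exp (mT/2 * potential)`, killed at the first bad round, is a supermartingale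
(`lintegral_exp_increment_le`, `law_potential_ge_le`). One application of Markov's inequality per
player controls all rounds at once, so the players' samples need `log (k/δ)` and no union bound over
rounds.

Finally `Φ ≥ w_i`, so a small potential says that `∑ err_i(f)/q ≤ (1 + a) * t`. Since every `q` is
at most about `(1 + 5a) * OPT` plus a multiple of `e`, averaging over the rounds gives `(1 + 12a) *
OPT + 25e`, which is the claim (`expErr_output_le`). -/

namespace CollabPAC

/-! ### Growth function: Sauer–Shelah for labellings and for mistakes. -/

section Growth

/-- A polynomial bound on partial sums of binomial coefficients. -/
lemma sum_choose_le (N d : ℕ) {x : ℝ} (hx : 0 < x) (hx1 : x ≤ 1) :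
    (∑ j ∈ Finset.Iic d, (N.choose j : ℝ)) ≤ (1 / x) ^ d * Real.exp (x * N) := by
  -- Since `x ≤ 1`, `x ^ d ≤ x ^ j` for `j ≤ d`; the binomial theorem and `1 + x ≤ exp x` do the
  -- rest. Leaving `x` free lets the factor `exp (x * N)` be absorbed later by a concentration
  -- exponent.
  have h1 : ∑ j ∈ Finset.Iic d, (N.choose j : ℝ) * x ^ d ≤ (x + 1) ^ N := by
    calc ∑ j ∈ Finset.Iic d, (N.choose j : ℝ) * x ^ d
        ≤ ∑ j ∈ Finset.Iic d, (N.choose j : ℝ) * x ^ j := by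
          refine Finset.sum_le_sum fun j hj => ?_
          exact mul_le_mul_of_nonneg_left
            (pow_le_pow_of_le_one hx.le hx1 (Finset.mem_Iic.1 hj)) (by positivity)
      _ ≤ ∑ j ∈ Finset.range (max d N + 1), (N.choose j : ℝ) * x ^ j := by
          refine Finset.sum_le_sum_of_subset_of_nonneg ?_ fun j _ _ => by positivity
          intro j hj
          simp only [Finset.mem_Iic, Finset.mem_range] at *
          omega
      _ = ∑ j ∈ Finset.range (N + 1), (N.choose j : ℝ) * x ^ j := by
          refine (Finset.sum_subset ?_ ?_).symm
          · intro j hj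
            simp only [Finset.mem_range] at *
            omega
          · intro j _ hj
            simp only [Finset.mem_range, not_lt] at hj
            rw [Nat.choose_eq_zero_of_lt (by omega)]
            simp
      _ = (x + 1) ^ N := by
          rw [add_pow]
          exact Finset.sum_congr rfl fun j _ => by rw [one_pow]; ring
  have h2 : (x + 1) ^ N ≤ Real.exp (x * N) := by
    rw [mul_comm, Real.exp_nat_mul]
    exact pow_le_pow_left₀ (by linarith) (Real.add_one_le_exp x) N
  rw [← Finset.sum_mul] at h1
  rw [one_div, inv_pow, inv_mul_eq_div, le_div_iff₀ (by positivity)]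
  exact h1.trans h2

/-- The labellings of the points `x i` by members of `F`. -/
noncomputable def traces {X ι : Type*} [Fintype ι] (F : Set (X → Bool)) (x : ι → X) :
    Finset (ι → Bool) := by
  classical
  exact Finset.univ.filter fun u => ∃ f ∈ F, ∀ i, u i = f (x i)

lemma mem_traces {X ι : Type*} [Fintype ι] {F : Set (X → Bool)} {x : ι → X} {u : ι → Bool} :
    u ∈ traces F x ↔ ∃ f ∈ F, ∀ i, u i = f (x i) := by
  simp [traces]

/-- Labellings are read as sets of indices, so that the Sauer–Shelah bound for finite set families
applies. The points `x i` may repeat, but `x` is injective on a shattered index set `A`, because a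
member of `F` picks out each index of `A` alone; so `x` carries `A` to a shattered set of points of
the same size. -/
lemma card_traces_le {X ι : Type*} [Fintype ι] {F : Set (X → Bool)} {d : ℕ} (hF : HasVCDim F d)
    (x : ι → X) :
    (traces F x).card ≤ ∑ j ∈ Finset.Iic d, (Fintype.card ι).choose j := by
  classical
  let s : (ι → Bool) → Finset ι := fun u => Finset.univ.filter fun i => u i = true
  have hs : Function.Injective s := by
    intro u v huv
    funext i
    have : i ∈ s u ↔ i ∈ s v := by rw [huv]
    simp only [s, Finset.mem_filter, Finset.mem_univ, true_and] at this
    exact Bool.eq_iff_iff.2 this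
  rw [← Finset.card_image_of_injective _ hs]
  refine (Finset.card_le_card_shatterer _).trans (Finset.card_shatterer_le_sum_vcDim.trans ?_)
  refine Finset.sum_le_sum_of_subset (Finset.Iic_subset_Iic.2 ?_)
  refine Finset.sup_le fun A hA => ?_
  rw [Finset.mem_shatterer] at hA
  have key : ∀ B ⊆ A, ∃ f ∈ F, ∀ i ∈ A, (f (x i) = true ↔ i ∈ B) := by
    intro B hB
    obtain ⟨u, hu, huB⟩ := hA hB
    obtain ⟨v, hv, rfl⟩ := Finset.mem_image.1 hu
    obtain ⟨f, hf, hfv⟩ := mem_traces.1 hv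
    refine ⟨f, hf, fun i hi => ?_⟩
    rw [← huB]
    simp [s, hi, hfv]
  have hinj : Set.InjOn x A := by
    intro i hi j hj hij
    obtain ⟨f, -, hf⟩ := key {i} (by simpa using hi)
    have h1 := (hf i hi).2 (by simp)
    have h2 := (hf j hj).1 (hij ▸ h1)
    exact (Finset.mem_singleton.1 h2).symm
  refine hF.2 ⟨A.image x, Finset.card_image_of_injOn hinj, fun g => ?_⟩
  obtain ⟨f, hf, hfA⟩ := key (A.filter fun i => g (x i) = true) (Finset.filter_subset _ _)
  refine ⟨f, hf, fun z hz => ?_⟩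
  obtain ⟨i, hi, rfl⟩ := Finset.mem_image.1 hz
  have := hfA i hi
  rw [Finset.mem_filter] at this
  rw [Bool.eq_iff_iff, this]
  exact ⟨fun h => h.2, fun h => ⟨hi, h⟩⟩

/-- The class of the mistakes `z ↦ [f z.1 ≠ z.2]` of the members of `F`. -/
def lossClass {X : Type*} (F : Set (X → Bool)) : Set (X × Bool → Bool) :=
  {g | ∃ f ∈ F, g = fun z => f z.1 ^^ z.2}

/-- Adding the fixed labels modulo 2 is an injection from the mistake patterns to the labellings by
`F`. -/
lemma card_traces_lossClass_le {X ι : Type*} [Fintype ι] {F : Set (X → Bool)} {d : ℕ}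
    (hF : HasVCDim F d) (z : ι → X × Bool) :
    (traces (lossClass F) z).card ≤ ∑ j ∈ Finset.Iic d, (Fintype.card ι).choose j := by
  refine le_trans ?_ (card_traces_le hF fun i => (z i).1)
  refine Finset.card_le_card_of_injOn (fun u i => u i ^^ (z i).2) ?_ ?_
  · intro u hu
    obtain ⟨g, ⟨f, hf, rfl⟩, hu⟩ := mem_traces.1 hu
    exact mem_traces.2 ⟨f, hf, fun i => by simp [hu]⟩
  · intro u _ v _ huv
    funext i
    have := congrFun huv i
    simpa using this

end Growth

/-! ### Symmetrization by a ghost sample and random exchanges. -/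

section Symmetrization

/-- The real number `1` or `0`. -/
def ind (b : Bool) : ℝ := if b then 1 else 0

lemma ind_le_one (b : Bool) : ind b ≤ 1 := by cases b <;> simp [ind]

lemma measurable_ind : Measurable ind := measurable_of_finite _

lemma exp_le_one_add_add_sq {x : ℝ} (hx : |x| ≤ 1) : Real.exp x ≤ 1 + x + x ^ 2 := by
  have := (abs_le.1 (Real.abs_exp_sub_one_sub_id_le hx)).2
  linarith

/-- Exchanging the two points of a pair. -/
lemma exp_swap_add_le {c l : ℝ} (hc : 0 < c) (hc1 : c ≤ 1) (hl : l = c / 6) (a b : Bool) :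
    Real.exp (l * (ind b - (1 + c) * ind a)) + Real.exp (l * (ind a - (1 + c) * ind b)) ≤ 2 := by
  have h1 : Real.exp (-(l * c)) ≤ 1 := Real.exp_le_one_iff.2 (by rw [neg_nonpos, hl]; positivity)
  have h2 : Real.exp l ≤ 1 + l + l ^ 2 :=
    exp_le_one_add_add_sq (by rw [hl, abs_of_pos (by positivity)]; linarith)
  have h3 : Real.exp (-(l * (1 + c))) ≤ 1 + -(l * (1 + c)) + (-(l * (1 + c))) ^ 2 :=
    exp_le_one_add_add_sq (by rw [abs_neg, hl, abs_of_pos (by positivity)]; nlinarith)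
  -- Only pairs with exactly one mistake matter. Their first-order gain is `-l * c` and their
  -- second-order loss at most `l ^ 2 * (1 + 4)`; `l = c / 6` makes the loss at most `5/6` of the
  -- gain.
  have h4 : l + l ^ 2 - l * (1 + c) + (l * (1 + c)) ^ 2 ≤ 0 := by
    have : l + l ^ 2 - l * (1 + c) + (l * (1 + c)) ^ 2 = l * (l + l * (1 + c) ^ 2 - c) := by ring
    rw [this]
    refine mul_nonpos_of_nonneg_of_nonpos (by rw [hl]; positivity) ?_
    have h5 : (1 + c) ^ 2 ≤ 4 := by nlinarith
    rw [hl]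
    nlinarith [mul_le_mul_of_nonneg_left h5 hc.le]
  cases a <;> cases b <;> simp only [ind, Bool.false_eq_true, if_true, if_false]
  · norm_num
  · have e1 : l * (1 - (1 + c) * 0) = l := by ring
    have e2 : l * (0 - (1 + c) * 1) = -(l * (1 + c)) := by ring
    rw [e1, e2]
    nlinarith
  · have e1 : l * (1 - (1 + c) * 0) = l := by ring
    have e2 : l * (0 - (1 + c) * 1) = -(l * (1 + c)) := by ring
    rw [e1, e2]
    nlinarith
  · have e : l * (1 - (1 + c) * 1) = -(l * c) := by ring
    rw [e]
    linarith

lemma lintegral_pi_prod {ι Z : Type*} [Fintype ι] [MeasurableSpace Z] (P : ι → Measure Z)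
    [∀ i, IsProbabilityMeasure (P i)] {f : ι → Z → ENNReal} (hf : ∀ i, Measurable (f i)) :
    ∫⁻ z, ∏ i, f i (z i) ∂Measure.pi P = ∏ i, ∫⁻ z, f i z ∂P i := by
  refine (lintegral_prod_eq_prod_lintegral_of_indepFun Finset.univ
    (fun i (z : ι → Z) => f i (z i))
    (iIndepFun_pi fun i => (hf i).aemeasurable)
    fun i => (hf i).comp (measurable_pi_apply i)).trans ?_
  refine Finset.prod_congr rfl fun i _ => ?_
  exact (measurePreserving_eval P i).lintegral_comp (hf i)

variable {Z : Type*} [MeasurableSpace Z]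

lemma lintegral_exp_ind (P : Measure Z) [IsProbabilityMeasure P] {g : Z → Bool} (hg : Measurable g)
    (l : ℝ) : ∫⁻ z, ENNReal.ofReal (Real.exp (l * ind (g z))) ∂P =
      ENNReal.ofReal (1 + P.real {z | g z = true} * (Real.exp l - 1)) := by
  have hs : MeasurableSet {z | g z = true} := hg (measurableSet_singleton true)
  have : ∀ z, Real.exp (l * ind (g z)) =
      1 + ({z | g z = true} : Set Z).indicator (fun _ => Real.exp l - 1) z := by
    intro z
    by_cases h : g z = true <;> simp [ind, Set.indicator, h]
  have hi : Integrable (fun z => Real.exp (l * ind (g z))) P := by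
    simp_rw [this]
    exact (integrable_const _).add ((integrable_const _).indicator hs)
  rw [← ofReal_integral_eq_lintegral_ofReal hi (ae_of_all _ fun z => (Real.exp_pos _).le)]
  simp_rw [this]
  rw [integral_add (integrable_const _) ((integrable_const _).indicator hs),
    integral_indicator_const _ hs]
  simp

/-- Jensen's inequality: the chord of `exp` over the segment from `0` to `l` lies above it. This is
what replaces the true error by the mistakes on a ghost sample. -/
lemma exp_le_lintegral_exp_ind (P : Measure Z) [IsProbabilityMeasure P] {g : Z → Bool}
    (hg : Measurable g) (l : ℝ) : ENNReal.ofReal (Real.exp (l * P.real {z | g z = true})) ≤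
      ∫⁻ z, ENNReal.ofReal (Real.exp (l * ind (g z))) ∂P := by
  rw [lintegral_exp_ind P hg]
  refine ENNReal.ofReal_le_ofReal ?_
  have h0 : 0 ≤ P.real {z | g z = true} := measureReal_nonneg
  have h1 : P.real {z | g z = true} ≤ 1 := measureReal_le_one
  have := convexOn_exp.2 (Set.mem_univ (0 : ℝ)) (Set.mem_univ l) (sub_nonneg.2 h1) h0 (by ring)
  simp only [smul_eq_mul, mul_zero, zero_add, Real.exp_zero, mul_one] at this
  rw [mul_comm l]
  linarith

lemma lintegral_exp_ind_le (P : Measure Z) [IsProbabilityMeasure P] {g : Z → Bool}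
    (hg : Measurable g) {l : ℝ} (hl : |l| ≤ 1) :
    ∫⁻ z, ENNReal.ofReal (Real.exp (l * ind (g z))) ∂P ≤
      ENNReal.ofReal (Real.exp (P.real {z | g z = true} * (l + l ^ 2))) := by
  rw [lintegral_exp_ind P hg]
  refine ENNReal.ofReal_le_ofReal ?_
  have h0 : 0 ≤ P.real {z | g z = true} := measureReal_nonneg
  have h1 := exp_le_one_add_add_sq hl
  have h2 := Real.add_one_le_exp (P.real {z | g z = true} * (l + l ^ 2))
  nlinarith [mul_le_mul_of_nonneg_left h1 h0]

/-- The factor of a pair of points with mistakes `p`, possibly exchanged. -/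
noncomputable def pairFactor (c l : ℝ) (s : Bool) (p : Bool × Bool) : ENNReal :=
  ENNReal.ofReal (Real.exp (l * (ind (if s then p.1 else p.2) -
    (1 + c) * ind (if s then p.2 else p.1))))

/-- Exchange the pairs selected by `s`. -/
def swapPairs {n : ℕ} (s : Fin n → Bool) (q : Fin n → Z × Z) : Fin n → Z × Z :=
  fun j => if s j then (q j).swap else q j

lemma measurePreserving_swapPairs {n : ℕ} (P : Measure Z) [IsProbabilityMeasure P]
    (s : Fin n → Bool) : MeasurePreserving (swapPairs s)
      (Measure.pi fun _ : Fin n => P.prod P) (Measure.pi fun _ : Fin n => P.prod P) := by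
  refine measurePreserving_pi (fun _ => P.prod P) (fun _ => P.prod P)
    (f := fun j z => if s j then z.swap else z) fun j => ?_
  cases s j
  · exact MeasurePreserving.id _
  · exact Measure.measurePreserving_swap

/-- For a fixed mistake pattern the exchanges act on each pair separately, so the sum factorizes,
and `exp_swap_add_le` bounds every factor by `2`. -/
lemma sum_prod_pairFactor_le {n : ℕ} {c l : ℝ} (hc : 0 < c) (hc1 : c ≤ 1) (hl : l = c / 6)
    (u : Fin n → Bool × Bool) : ∑ s : Fin n → Bool, ∏ j, pairFactor c l (s j) (u j) ≤ 2 ^ n := by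
  classical
  have : ∑ s : Fin n → Bool, ∏ j, pairFactor c l (s j) (u j) =
      ∏ j, ∑ s : Bool, pairFactor c l s (u j) := by
    rw [Finset.prod_univ_sum, Fintype.piFinset_univ]
  rw [this]
  calc ∏ j, ∑ s : Bool, pairFactor c l s (u j) ≤ ∏ _j : Fin n, (2 : ENNReal) := by
        refine Finset.prod_le_prod' fun j _ => ?_
        rw [Fintype.sum_bool]
        simp only [pairFactor, if_true, Bool.false_eq_true, if_false]
        rw [← ENNReal.ofReal_add (Real.exp_pos _).le (Real.exp_pos _).le]
        refine (ENNReal.ofReal_le_ofReal (exp_swap_add_le hc hc1 hl (u j).2 (u j).1)).trans ?_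
        simp
    _ = 2 ^ n := by simp

/-- The chosen `h s` varies with the exchange `s`, but the underlying `2n` points do not. Each term
is therefore at most the sum over all patterns that `H` induces on these points; once the sums are
interchanged every pattern is fixed. -/
lemma sum_swapPairs_le {W : Type*} {n : ℕ} {c l : ℝ} (hc : 0 < c) (hc1 : c ≤ 1) (hl : l = c / 6)
    (H : Set (W → Bool)) (q : Fin n → W × W) (h : (Fin n → Bool) → W → Bool) (hH : ∀ s, h s ∈ H) :
    ∑ s : Fin n → Bool, ∏ j,
      pairFactor c l false (h s (swapPairs s q j).1, h s (swapPairs s q j).2) ≤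
    (traces H fun p : Fin n × Bool => if p.2 then (q p.1).2 else (q p.1).1).card * 2 ^ n := by
  set q' : Fin n × Bool → W := fun p => if p.2 then (q p.1).2 else (q p.1).1 with hq'
  have hle : ∀ s : Fin n → Bool, ∏ j,
      pairFactor c l false (h s (swapPairs s q j).1, h s (swapPairs s q j).2) ≤
      ∑ u ∈ traces H q', ∏ j, pairFactor c l (s j) (u (j, false), u (j, true)) := by
    intro s
    have hu : (fun p => h s (q' p)) ∈ traces H q' := mem_traces.2 ⟨h s, hH s, fun _ => rfl⟩
    have heq : ∏ j, pairFactor c l false (h s (swapPairs s q j).1, h s (swapPairs s q j).2) =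
        ∏ j, pairFactor c l (s j) (h s (q' (j, false)), h s (q' (j, true))) := by
      refine Finset.prod_congr rfl fun j _ => ?_
      cases hj : s j <;> simp [pairFactor, hq', swapPairs, hj]
    rw [heq]
    change (fun u : Fin n × Bool → Bool => ∏ j,
      pairFactor c l (s j) (u (j, false), u (j, true))) (fun p => h s (q' p)) ≤ _
    generalize (fun p => h s (q' p)) = u₀ at hu ⊢
    generalize traces H q' = T at hu ⊢
    exact Finset.single_le_sum (f := fun u : Fin n × Bool → Bool => ∏ j,
      pairFactor c l (s j) (u (j, false), u (j, true))) (fun _ _ => zero_le) hu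
  refine (Finset.sum_le_sum fun s _ => hle s).trans ?_
  rw [Finset.sum_comm]
  refine (Finset.sum_le_sum fun u _ =>
    sum_prod_pairFactor_le hc hc1 hl fun j => (u (j, false), u (j, true))).trans ?_
  rw [Finset.sum_const, nsmul_eq_mul]

/-- Symmetrization: the exponential moment of the excess of the true over the empirical error. -/
theorem lintegral_exp_excess_le {n N : ℕ} {c l : ℝ} (hc : 0 < c) (hc1 : c ≤ 1) (hl : l = c / 6)
    (P : Measure Z) [IsProbabilityMeasure P] (H : Set (Z → Bool))
    (hN : ∀ q : Fin n × Bool → Z, (traces H q).card ≤ N)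
    (g : (Fin n → Z) → Z → Bool) (hg : Measurable fun p : (Fin n → Z) × Z => g p.1 p.2)
    (hgH : ∀ S, g S ∈ H) :
    ∫⁻ S, ENNReal.ofReal (Real.exp (l * (n * P.real {z | g S z = true} -
      (1 + c) * ∑ j, ind (g S (S j))))) ∂(Measure.pi fun _ : Fin n => P) ≤ N := by
  classical
  have hgS : ∀ S, Measurable (g S) := fun S => hg.comp (measurable_const.prodMk measurable_id)
  let G : (Fin n → Z × Z) → ENNReal := fun q =>
    ∏ j, pairFactor c l false (g (fun i => (q i).1) (q j).1, g (fun i => (q i).1) (q j).2)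
  have hpf : Measurable (pairFactor c l false) := measurable_of_finite _
  have hGm : Measurable G := by
    refine Finset.measurable_prod _ fun j _ => hpf.comp (Measurable.prodMk ?_ ?_)
    · exact hg.comp (Measurable.prodMk (by fun_prop) (by fun_prop))
    · exact hg.comp (Measurable.prodMk (by fun_prop) (by fun_prop))
  -- a ghost sample
  have ghost : ∫⁻ S, ENNReal.ofReal (Real.exp (l * (n * P.real {z | g S z = true} -
      (1 + c) * ∑ j, ind (g S (S j))))) ∂(Measure.pi fun _ : Fin n => P) ≤
      ∫⁻ q, G q ∂(Measure.pi fun _ : Fin n => P.prod P) := by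
    have hmp := measurePreserving_arrowProdEquivProdArrow Z Z (Fin n) (fun _ => P) (fun _ => P)
    let K : (Fin n → Z) × (Fin n → Z) → ENNReal := fun q =>
      ∏ j, pairFactor c l false (g q.1 (q.1 j), g q.1 (q.2 j))
    have hK : Measurable K := by
      refine Finset.measurable_prod _ fun j _ => hpf.comp (Measurable.prodMk ?_ ?_)
      · exact hg.comp (Measurable.prodMk (by fun_prop) (by fun_prop))
      · exact hg.comp (Measurable.prodMk (by fun_prop) (by fun_prop))
    have e : ∫⁻ q, G q ∂(Measure.pi fun _ : Fin n => P.prod P) =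
        ∫⁻ q, K q ∂((Measure.pi fun _ : Fin n => P).prod (Measure.pi fun _ : Fin n => P)) :=
      (hmp.lintegral_comp hK)
    rw [e, lintegral_prod _ hK.aemeasurable]
    refine lintegral_mono fun S => ?_
    have split : ∀ S' : Fin n → Z, K (S, S') =
        ENNReal.ofReal (Real.exp (l * -((1 + c) * ∑ j, ind (g S (S j))))) *
          ∏ j, ENNReal.ofReal (Real.exp (l * ind (g S (S' j)))) := by
      intro S'
      simp only [K, pairFactor, Bool.false_eq_true, if_false]
      rw [← ENNReal.ofReal_prod_of_nonneg fun _ _ => (Real.exp_pos _).le,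
        ← ENNReal.ofReal_prod_of_nonneg fun _ _ => (Real.exp_pos _).le,
        ← ENNReal.ofReal_mul (Real.exp_pos _).le, ← Real.exp_sum, ← Real.exp_sum, ← Real.exp_add]
      congr 2
      rw [← Finset.mul_sum, ← Finset.mul_sum, Finset.sum_sub_distrib, ← Finset.mul_sum]
      ring
    simp_rw [split]
    have hm : ∀ j : Fin n, Measurable fun z => ENNReal.ofReal (Real.exp (l * ind (g S z))) :=
      fun _ => (ENNReal.measurable_ofReal.comp (Real.measurable_exp.comp
        ((measurable_ind.comp (hgS S)).const_mul l)))
    have hmp : Measurable fun S' : Fin n → Z =>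
        ∏ j, ENNReal.ofReal (Real.exp (l * ind (g S (S' j)))) :=
      Finset.measurable_prod _ fun j _ => (hm j).comp (measurable_pi_apply j)
    rw [lintegral_const_mul _ hmp, lintegral_pi_prod (fun _ => P) hm]
    rw [show l * (n * P.real {z | g S z = true} - (1 + c) * ∑ j, ind (g S (S j))) =
      l * -((1 + c) * ∑ j, ind (g S (S j))) + n * (l * P.real {z | g S z = true}) by ring,
      Real.exp_add, ENNReal.ofReal_mul (Real.exp_pos _).le, Real.exp_nat_mul,
      ENNReal.ofReal_pow (Real.exp_pos _).le]
    gcongr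
    simpa using pow_le_pow_left' (exp_le_lintegral_exp_ind P (hgS S) l) n
  refine ghost.trans ?_
  -- average over the exchanges
  have hswap : ∀ s : Fin n → Bool, ∫⁻ q, G q ∂(Measure.pi fun _ : Fin n => P.prod P) =
      ∫⁻ q, G (swapPairs s q) ∂(Measure.pi fun _ : Fin n => P.prod P) := fun s =>
    ((measurePreserving_swapPairs P s).lintegral_comp hGm).symm
  have hpoint : ∀ q : Fin n → Z × Z, ∑ s : Fin n → Bool, G (swapPairs s q) ≤ N * 2 ^ n := by
    intro q
    refine (sum_swapPairs_le hc hc1 hl H q (fun s => g fun i => (swapPairs s q i).1)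
      fun s => hgH _).trans ?_
    gcongr
    exact hN _
  have htot : 2 ^ n * ∫⁻ q, G q ∂(Measure.pi fun _ : Fin n => P.prod P) ≤ 2 ^ n * N := by
    calc 2 ^ n * ∫⁻ q, G q ∂(Measure.pi fun _ : Fin n => P.prod P)
        = ∑ s : Fin n → Bool, ∫⁻ q, G (swapPairs s q) ∂(Measure.pi fun _ : Fin n => P.prod P) := by
          simp_rw [← hswap]
          simp
      _ = ∫⁻ q, ∑ s : Fin n → Bool, G (swapPairs s q) ∂(Measure.pi fun _ : Fin n => P.prod P) :=
          (lintegral_finsetSum _ fun s _ =>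
            hGm.comp (measurePreserving_swapPairs P s).measurable).symm
      _ ≤ ∫⁻ _q, (N * 2 ^ n : ENNReal) ∂(Measure.pi fun _ : Fin n => P.prod P) :=
          lintegral_mono hpoint
      _ = 2 ^ n * N := by simp [mul_comm]
  exact (ENNReal.mul_le_mul_iff_right (by simp) (by simp)).1 htot

end Symmetrization

/-! ### Concentration for the samples of one round. -/

section RoundSamples

variable {X : Type*}

/-- The mistakes of a classifier. -/
def loss (f : X → Bool) (z : X × Bool) : Bool := f z.1 ^^ z.2

lemma loss_eq_true {f : X → Bool} {z : X × Bool} : loss f z = true ↔ f z.1 ≠ z.2 := by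
  simp [loss]

lemma empErr_eq {n : ℕ} (S : Fin n → X × Bool) (f : X → Bool) :
    empErr S f = (∑ j, ind (loss f (S j))) / n := by
  classical
  simp only [empErr, ind, loss_eq_true]
  congr 1
  rw [Finset.sum_boole]

lemma natCast_mul_empErr {n : ℕ} (hn : 0 < n) (S : Fin n → X × Bool) (f : X → Bool) :
    n * empErr S f = ∑ j, ind (loss f (S j)) := by
  rw [empErr_eq]
  field_simp

lemma empErr_nonneg {n : ℕ} (S : Fin n → X × Bool) (f : X → Bool) : 0 ≤ empErr S f := by
  rw [empErr]; positivity

lemma empErr_le_one {n : ℕ} (S : Fin n → X × Bool) (f : X → Bool) : empErr S f ≤ 1 := by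
  rw [empErr_eq]
  refine div_le_one_of_le₀ ?_ (by positivity)
  calc ∑ j, ind (loss f (S j)) ≤ ∑ _j : Fin n, (1 : ℝ) :=
        Finset.sum_le_sum fun j _ => ind_le_one _
    _ = n := by simp

variable [MeasurableSpace X]

lemma measurable_loss {f : X → Bool} (hf : Measurable f) : Measurable (loss f) :=
  (measurable_of_finite fun p : Bool × Bool => p.1 ^^ p.2).comp
    ((hf.comp measurable_fst).prodMk measurable_snd)

lemma err_eq (D : Measure (X × Bool)) (f : X → Bool) :
    err D f = D.real {z | loss f z = true} := by
  simp only [err, loss_eq_true]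

lemma err_nonneg (D : Measure (X × Bool)) (f : X → Bool) : 0 ≤ err D f := measureReal_nonneg

lemma measurable_loss_comp {A : Type*} [MeasurableSpace A] {O : A → X → Bool}
    (hO : Measurable fun p : A × X => O p.1 p.2) :
    Measurable fun p : A × (X × Bool) => loss (O p.1) p.2 :=
  (measurable_of_finite fun p : Bool × Bool => p.1 ^^ p.2).comp
    ((hO.comp (measurable_fst.prodMk (measurable_fst.comp measurable_snd))).prodMk
      (measurable_snd.comp measurable_snd))

lemma measurable_err_comp {A : Type*} [MeasurableSpace A] {O : A → X → Bool}
    (hO : Measurable fun p : A × X => O p.1 p.2) (D : Measure (X × Bool))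
    [IsProbabilityMeasure D] : Measurable fun p => err D (O p) := by
  simp_rw [err_eq]
  have : MeasurableSet {p : A × (X × Bool) | loss (O p.1) p.2 = true} :=
    measurable_loss_comp hO (measurableSet_singleton true)
  exact (measurable_measure_prodMk_left this).ennreal_toReal

lemma measurable_empErr_comp {A : Type*} [MeasurableSpace A] {O : A → X → Bool}
    (hO : Measurable fun p : A × X => O p.1 p.2) {n : ℕ} {S : A → Fin n → X × Bool}
    (hS : Measurable S) : Measurable fun p => empErr (S p) (O p) := by
  simp_rw [empErr_eq]
  refine (Finset.measurable_sum _ fun j _ => measurable_ind.comp ?_).div_const _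
  exact (measurable_loss_comp hO).comp (measurable_id.prodMk ((measurable_pi_apply j).comp hS))

/-- Markov's inequality for an exponential moment. -/
lemma measure_le_of_exp_moment {A : Type*} [MeasurableSpace A] (μ : Measure A) {Y : A → ℝ}
    (hY : Measurable Y) {c B : ℝ} (hB : 0 ≤ B)
    (h : ∫⁻ x, ENNReal.ofReal (Real.exp (Y x)) ∂μ ≤ ENNReal.ofReal B) :
    μ {x | c ≤ Y x} ≤ ENNReal.ofReal (B * Real.exp (-c)) := by
  have h1 := mul_meas_ge_le_lintegral₀ (μ := μ)
    (Real.measurable_exp.comp hY).ennreal_ofReal.aemeasurable (ENNReal.ofReal (Real.exp c))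
  have h2 : {x | ENNReal.ofReal (Real.exp c) ≤ ENNReal.ofReal ((Real.exp ∘ Y) x)} =
      {x | c ≤ Y x} := by
    ext x
    simp [ENNReal.ofReal_le_ofReal_iff (Real.exp_pos _).le]
  rw [h2] at h1
  have h3 := h1.trans h
  rw [ENNReal.ofReal_mul hB, Real.exp_neg, ENNReal.ofReal_inv_of_pos (Real.exp_pos _),
    ← div_eq_mul_inv, ENNReal.le_div_iff_mul_le (by simp [Real.exp_pos]) (by simp), mul_comm]
  exact h3

/-- The classifier chosen from the sample does not overfit: a multiplicative bound. -/
theorem measure_overfit_le {F : Set (X → Bool)} {d n : ℕ} (hF : HasVCDim F d) (hn : 0 < n)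
    {a e : ℝ} (ha : 0 < a) (ha1 : a ≤ 1) (he : 0 < e) (he1 : e ≤ 1)
    (P : Measure (X × Bool)) [IsProbabilityMeasure P] {O : (Fin n → X × Bool) → X → Bool}
    (hO : Measurable fun p : (Fin n → X × Bool) × X => O p.1 p.2) (hOF : ∀ S, O S ∈ F) :
    (Measure.pi fun _ : Fin n => P) {S | ¬ err P (O S) ≤ (1 + a) * empErr S (O S) + e} ≤
      ENNReal.ofReal ((24 / (a * e)) ^ d * Real.exp (-(a * e / 12 * n))) := by
  -- With `x = a * e / 24` and `2n` points, the growth function costs `exp (a * e / 12 * n)`, half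
  -- of the exponent `a * e / 6 * n` that Markov's inequality gains below.
  have hx : 0 < a * e / 24 := by positivity
  have hx1 : a * e / 24 ≤ 1 := by nlinarith
  have key := lintegral_exp_excess_le (c := a) ha ha1 rfl P (lossClass F)
    (fun q => card_traces_lossClass_le hF q) (fun S => loss (O S)) (measurable_loss_comp hO)
    (fun S => ⟨O S, hOF S, rfl⟩)
  have hcard : Fintype.card (Fin n × Bool) = n * 2 := by simp
  rw [hcard] at key
  have hgrow : ((∑ j ∈ Finset.Iic d, (n * 2).choose j : ℕ) : ENNReal) ≤
      ENNReal.ofReal ((24 / (a * e)) ^ d * Real.exp (a * e / 12 * n)) := by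
    rw [← ENNReal.ofReal_natCast]
    refine ENNReal.ofReal_le_ofReal ?_
    have := sum_choose_le (n * 2) d hx hx1
    rw [one_div_div] at this
    push_cast at this ⊢
    convert this using 3
    ring
  have hm : Measurable fun S : Fin n → X × Bool => a / 6 * (n * P.real {z | loss (O S) z = true} -
      (1 + a) * ∑ j, ind (loss (O S) (S j))) := by
    have h1 := measurable_err_comp hO P
    have h2 := measurable_empErr_comp hO (n := n) measurable_id
    simp_rw [← natCast_mul_empErr hn, ← err_eq]
    exact ((h1.const_mul _).sub ((h2.const_mul _).const_mul _)).const_mul _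
  have hM := measure_le_of_exp_moment (c := a * e / 6 * n) _ hm (by positivity) (key.trans hgrow)
  rw [mul_assoc, ← Real.exp_add] at hM
  have e1 : a * e / 12 * n + -(a * e / 6 * n) = -(a * e / 12 * n) := by ring
  rw [e1] at hM
  refine (measure_mono fun S hS => ?_).trans hM
  simp only [Set.mem_ofPred_eq, not_le] at hS ⊢
  rw [← natCast_mul_empErr hn, ← err_eq]
  have hn' : (0 : ℝ) < n := by exact_mod_cast hn
  have := mul_le_mul_of_nonneg_left hS.le (by positivity : 0 ≤ a / 6 * n)
  nlinarith

/-- A multiplicative Chernoff bound for the empirical error of one classifier. -/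
theorem measure_empErr_gt_le {n : ℕ} (hn : 0 < n) {a e : ℝ} (ha : 0 < a) (ha1 : a ≤ 1)
    (P : Measure (X × Bool)) [IsProbabilityMeasure P] {f : X → Bool} (hf : Measurable f) :
    (Measure.pi fun _ : Fin n => P) {S | ¬ empErr S f ≤ (1 + a) * err P f + e} ≤
      ENNReal.ofReal (Real.exp (-(a * e * n))) := by
  have hl := measurable_loss hf
  have hint : ∫⁻ S, ENNReal.ofReal (Real.exp (a * ∑ j, ind (loss f (S j))))
      ∂(Measure.pi fun _ : Fin n => P) ≤ ENNReal.ofReal (Real.exp (n * (err P f * (a + a ^ 2)))) := by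
    have : ∀ S : Fin n → X × Bool, ENNReal.ofReal (Real.exp (a * ∑ j, ind (loss f (S j)))) =
        ∏ j, ENNReal.ofReal (Real.exp (a * ind (loss f (S j)))) := by
      intro S
      rw [← ENNReal.ofReal_prod_of_nonneg fun _ _ => (Real.exp_pos _).le, ← Real.exp_sum,
        ← Finset.mul_sum]
    simp_rw [this]
    rw [lintegral_pi_prod (fun _ => P) (f := fun _ z => ENNReal.ofReal (Real.exp (a * ind (loss f z))))
      fun _ => (Real.measurable_exp.comp ((measurable_ind.comp hl).const_mul a)).ennreal_ofReal]
    rw [Real.exp_nat_mul, ENNReal.ofReal_pow (Real.exp_pos _).le, err_eq]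
    simpa using pow_le_pow_left'
      (lintegral_exp_ind_le P hl (l := a) (by rwa [abs_of_pos ha])) n
  have hm : Measurable fun S : Fin n → X × Bool => a * ∑ j, ind (loss f (S j)) :=
    (Finset.measurable_sum _ fun j _ => (measurable_ind.comp hl).comp
      (measurable_pi_apply j)).const_mul a
  -- The exponential parameter is `a` itself, so the moment exponent `err * (a + a ^ 2) * n` is
  -- exactly `a * n` times the allowed mean `(1 + a) * err`.
  have hM := measure_le_of_exp_moment (c := n * (err P f * (a + a ^ 2)) + a * e * n) _ hm
    (Real.exp_pos _).le hint
  rw [← Real.exp_add] at hM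
  refine (measure_mono fun S hS => ?_).trans (hM.trans_eq (by congr 2; ring))
  simp only [Set.mem_ofPred_eq, not_le] at hS ⊢
  rw [← natCast_mul_empErr hn]
  have hn' : (0 : ℝ) < n := by exact_mod_cast hn
  have := mul_le_mul_of_nonneg_left hS.le (by positivity : 0 ≤ a * n)
  nlinarith

/-- The exponential moment of a linear combination of the numbers of mistakes of the players. -/
theorem lintegral_exp_players_le {k m : ℕ} (D : Fin k → Measure (X × Bool))
    [∀ i, IsProbabilityMeasure (D i)] {f : X → Bool} (hf : Measurable f) {b : Fin k → ℝ}
    (hb : ∀ i, |b i| ≤ 1) :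
    ∫⁻ T, ENNReal.ofReal (Real.exp (∑ i, b i * (m * empErr (T i) f)))
      ∂(Measure.pi fun i => Measure.pi fun _ : Fin m => D i) ≤
    ENNReal.ofReal (Real.exp (m * ∑ i, err (D i) f * (b i + b i ^ 2))) := by
  have hl := measurable_loss hf
  have hmi : ∀ i, Measurable fun z => ENNReal.ofReal (Real.exp (b i * ind (loss f z))) := fun i =>
    (Real.measurable_exp.comp ((measurable_ind.comp hl).const_mul _)).ennreal_ofReal
  have : ∀ T : Fin k → Fin m → X × Bool,
      ENNReal.ofReal (Real.exp (∑ i, b i * (m * empErr (T i) f))) =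
      ∏ i, ∏ j, ENNReal.ofReal (Real.exp (b i * ind (loss f (T i j)))) := by
    intro T
    rw [Real.exp_sum, ENNReal.ofReal_prod_of_nonneg fun _ _ => (Real.exp_pos _).le]
    refine Finset.prod_congr rfl fun i _ => ?_
    rw [← ENNReal.ofReal_prod_of_nonneg fun _ _ => (Real.exp_pos _).le, ← Real.exp_sum,
      ← Finset.mul_sum]
    rcases Nat.eq_zero_or_pos m with rfl | hm
    · simp
    · rw [natCast_mul_empErr hm]
  simp_rw [this]
  rw [lintegral_pi_prod (fun i => Measure.pi fun _ : Fin m => D i)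
    (f := fun i T => ∏ j, ENNReal.ofReal (Real.exp (b i * ind (loss f (T j)))))
    fun i => Finset.measurable_prod _ fun j _ => (hmi i).comp (measurable_pi_apply j)]
  rw [Finset.mul_sum, Real.exp_sum, ENNReal.ofReal_prod_of_nonneg fun _ _ => (Real.exp_pos _).le]
  refine Finset.prod_le_prod' fun i _ => ?_
  rw [lintegral_pi_prod (fun _ => D i)
    (f := fun _ z => ENNReal.ofReal (Real.exp (b i * ind (loss f z)))) fun _ => hmi i]
  rw [Real.exp_nat_mul, ENNReal.ofReal_pow (Real.exp_pos _).le, err_eq]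
  simpa using pow_le_pow_left' (lintegral_exp_ind_le (D i) hl (hb i)) m

/-- The error under the mixture with weights `w`. -/
noncomputable def mixErr {k : ℕ} (D : Fin k → Measure (X × Bool)) (w : Fin k → ℝ) (f : X → Bool) :
    ℝ :=
  ∑ i, w i / (∑ j, w j) * err (D i) f

variable {k : ℕ}

lemma isProbabilityMeasure_mixture (hk : 0 < k) (D : Fin k → Measure (X × Bool))
    [∀ i, IsProbabilityMeasure (D i)] {w : Fin k → ℝ} (hw : ∀ i, 0 < w i) :
    IsProbabilityMeasure (mixture D w) := by
  have : NeZero k := ⟨hk.ne'⟩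
  have hpos : 0 < ∑ j, w j := Finset.sum_pos (fun i _ => hw i) Finset.univ_nonempty
  constructor
  simp only [mixture, Measure.coe_finsetSum, Finset.sum_apply, Measure.smul_apply, measure_univ,
    smul_eq_mul, mul_one]
  rw [← ENNReal.ofReal_sum_of_nonneg fun i _ => (div_pos (hw i) hpos).le, ← Finset.sum_div,
    div_self hpos.ne', ENNReal.ofReal_one]

lemma err_mixture (D : Fin k → Measure (X × Bool))
    [∀ i, IsProbabilityMeasure (D i)] {w : Fin k → ℝ} (hw : ∀ i, 0 < w i) (f : X → Bool) :
    err (mixture D w) f = mixErr D w f := by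
  have hpos : 0 ≤ ∑ j, w j := Finset.sum_nonneg (fun i _ => (hw i).le)
  simp only [err, mixErr, Measure.real, mixture, Measure.coe_finsetSum, Finset.sum_apply,
    Measure.smul_apply, smul_eq_mul]
  rw [ENNReal.toReal_sum fun i _ => ENNReal.mul_ne_top ENNReal.ofReal_ne_top (measure_ne_top _ _)]
  refine Finset.sum_congr rfl fun i _ => ?_
  rw [ENNReal.toReal_mul, ENNReal.toReal_ofReal (div_nonneg (hw i).le hpos)]

lemma sum_div_sum_eq_one (hk : 0 < k) {w : Fin k → ℝ} (hw : ∀ i, 0 < w i) :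
    ∑ i, w i / ∑ j, w j = 1 := by
  have : NeZero k := ⟨hk.ne'⟩
  rw [← Finset.sum_div,
    div_self (Finset.sum_pos (fun i _ => hw i) Finset.univ_nonempty).ne']

lemma mixErr_le (hk : 0 < k) {D : Fin k → Measure (X × Bool)} {w : Fin k → ℝ}
    (hw : ∀ i, 0 < w i) {f : X → Bool} {B : ℝ} (hB : ∀ i, err (D i) f ≤ B) :
    mixErr D w f ≤ B := by
  calc mixErr D w f ≤ ∑ i, w i / (∑ j, w j) * B := Finset.sum_le_sum fun i _ =>
        mul_le_mul_of_nonneg_left (hB i)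
          (div_nonneg (hw i).le (Finset.sum_nonneg fun j _ => (hw j).le))
    _ = B := by rw [← Finset.sum_mul, sum_div_sum_eq_one hk hw, one_mul]

end RoundSamples

/-! ### The law of the adaptive process: measurability, supermartingales, union bound. -/

section Rounds

variable {X : Type*} {k mS mT : ℕ}

lemma step_nonneg {ε α : ℝ} (hε : 0 < ε) (hα : 0 < α) (O : (Fin mS → X × Bool) → X → Bool)
    (z : Round X k mS mT) (i : Fin k) : 0 ≤ step ε α O z i := by
  have h1 := empErr_nonneg (z.2 i) (O z.1)
  have h2 := empErr_nonneg z.1 (O z.1)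
  have h3 : 0 < eps' ε := by unfold eps'; positivity
  have h4 : 0 < alpha' α := by unfold alpha'; positivity
  unfold step
  positivity

lemma weights_pos {ε α : ℝ} (hε : 0 < ε) (hα : 0 < α) (O : (Fin mS → X × Bool) → X → Bool)
    (r : ℕ) (h : Fin r → Round X k mS mT) (i : Fin k) : 0 < weights ε α O r h i := by
  induction r with
  | zero => simp [weights]
  | succ r ih =>
    rw [weights]
    exact mul_pos (ih _) (by linarith [step_nonneg hε hα O (h (Fin.last r)) i])

/-- All rounds satisfy a condition on the current weights and the sample from the mixture. -/
def AllRounds (ε α : ℝ) (O : (Fin mS → X × Bool) → X → Bool)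
    (good : (Fin k → ℝ) → (Fin mS → X × Bool) → Prop) :
    (r : ℕ) → (Fin r → Round X k mS mT) → Prop
  | 0, _ => True
  | r + 1, h => AllRounds ε α O good r (fun j => h j.castSucc) ∧
      good (weights ε α O r fun j => h j.castSucc) (h (Fin.last r)).1

lemma AllRounds.exists_weights {ε α : ℝ} {O : (Fin mS → X × Bool) → X → Bool}
    {good : (Fin k → ℝ) → (Fin mS → X × Bool) → Prop} {r : ℕ} {h : Fin r → Round X k mS mT}
    (hh : AllRounds ε α O good r h) (j : Fin r) : ∃ w, good w (h j).1 := by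
  induction r with
  | zero => exact j.elim0
  | succ r ih =>
    refine Fin.lastCases ⟨_, hh.2⟩ (fun j => ?_) j
    exact ih (h := fun j => h j.castSucc) hh.1 j

lemma weights_snoc (ε α : ℝ) (O : (Fin mS → X × Bool) → X → Bool) {r : ℕ}
    (h : Fin r → Round X k mS mT) (z : Round X k mS mT) (i : Fin k) :
    weights ε α O (r + 1) (Fin.snoc (α := fun _ => Round X k mS mT) h z) i =
      weights ε α O r h i * (1 + step ε α O z i) := by
  simp [weights]

lemma allRounds_snoc {ε α : ℝ} {O : (Fin mS → X × Bool) → X → Bool}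
    {good : (Fin k → ℝ) → (Fin mS → X × Bool) → Prop} {r : ℕ}
    {h : Fin r → Round X k mS mT} {z : Round X k mS mT} :
    AllRounds ε α O good (r + 1) (Fin.snoc (α := fun _ => Round X k mS mT) h z) ↔
      AllRounds ε α O good r h ∧ good (weights ε α O r h) z.1 := by
  simp [AllRounds]

variable [MeasurableSpace X]

lemma measurable_step (ε α : ℝ) {O : (Fin mS → X × Bool) → X → Bool}
    (hO : Measurable fun p : (Fin mS → X × Bool) × X => O p.1 p.2) (i : Fin k) :
    Measurable fun z : Round X k mS mT => step ε α O z i := by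
  have hO' : Measurable fun p : Round X k mS mT × X => O p.1.1 p.2 :=
    hO.comp ((measurable_fst.comp measurable_fst).prodMk measurable_snd)
  have hT : Measurable fun z : Round X k mS mT => z.2 i :=
    (measurable_pi_apply i).comp measurable_snd
  have h1 := measurable_empErr_comp (O := fun z : Round X k mS mT => O z.1) hO' hT
  have h2 := measurable_empErr_comp (O := fun z : Round X k mS mT => O z.1) hO' measurable_fst
  exact ((h1.mul_const _).mul_const _).div ((h2.const_mul _).add_const _)

lemma measurable_init {r : ℕ} : Measurable fun (h : Fin (r + 1) → Round X k mS mT) =>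
    fun j : Fin r => h j.castSucc :=
  measurable_pi_lambda _ fun _ => measurable_pi_apply _

lemma measurable_weights (ε α : ℝ) {O : (Fin mS → X × Bool) → X → Bool}
    (hO : Measurable fun p : (Fin mS → X × Bool) × X => O p.1 p.2) (r : ℕ) :
    Measurable fun h : Fin r → Round X k mS mT => weights ε α O r h := by
  induction r with
  | zero =>
    have : (fun h : Fin 0 → Round X k mS mT => weights ε α O 0 h) = fun _ _ => 1 := by
      funext h i
      simp [weights]
    rw [this]
    exact measurable_const
  | succ r ih =>
    refine measurable_pi_lambda _ fun i => ?_
    simp only [weights]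
    refine ((measurable_pi_apply i).comp (ih.comp measurable_init)).mul ?_
    have hlast : Measurable fun h : Fin (r + 1) → Round X k mS mT => h (Fin.last r) :=
      measurable_pi_apply _
    exact ((measurable_step ε α hO i).comp hlast).const_add 1

lemma measurable_snoc {r : ℕ} :
    Measurable fun p : (Fin r → Round X k mS mT) × Round X k mS mT =>
      (Fin.snoc (α := fun _ => Round X k mS mT) p.1 p.2 : Fin (r + 1) → Round X k mS mT) := by
  refine measurable_pi_lambda _ fun j => ?_
  refine Fin.lastCases ?_ (fun j => ?_) j
  · simpa using measurable_snd
  · simp only [Fin.snoc_castSucc]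
    exact (measurable_pi_apply j).comp measurable_fst

lemma measurableSet_allRounds (ε α : ℝ) {O : (Fin mS → X × Bool) → X → Bool}
    (hO : Measurable fun p : (Fin mS → X × Bool) × X => O p.1 p.2)
    {good : (Fin k → ℝ) → (Fin mS → X × Bool) → Prop}
    (hgood : MeasurableSet {p : (Fin k → ℝ) × (Fin mS → X × Bool) | good p.1 p.2}) (r : ℕ) :
    MeasurableSet {h : Fin r → Round X k mS mT | AllRounds ε α O good r h} := by
  induction r with
  | zero => simp [AllRounds]
  | succ r ih =>
    simp only [AllRounds]
    refine (measurable_init ih).inter ?_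
    exact (((measurable_weights ε α hO r).comp measurable_init).prodMk
      (measurable_fst.comp (measurable_pi_apply (Fin.last r)))) hgood

variable (D : Fin k → Measure (X × Bool)) [∀ i, IsProbabilityMeasure (D i)]

lemma isProbabilityMeasure_roundLaw (hk : 0 < k) {w : Fin k → ℝ} (hw : ∀ i, 0 < w i) :
    IsProbabilityMeasure (roundLaw D w : Measure (Round X k mS mT)) := by
  have := isProbabilityMeasure_mixture hk D hw
  unfold roundLaw
  infer_instance

/-- Measurability of a family of probability measures may be tested on a π-system; on rectangles the
product measures are products of quotients of the weights. -/
lemma measurable_roundLaw (hk : 0 < k) {A : Type*} [MeasurableSpace A] {w : A → Fin k → ℝ}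
    (hw : Measurable w) (hpos : ∀ x i, 0 < w x i) :
    Measurable fun x => (roundLaw D (w x) : Measure (Round X k mS mT)) := by
  have hmix : ∀ x, IsProbabilityMeasure (mixture D (w x)) := fun x =>
    isProbabilityMeasure_mixture hk D (hpos x)
  have hround : ∀ x, IsProbabilityMeasure (roundLaw D (w x) : Measure (Round X k mS mT)) :=
    fun x => isProbabilityMeasure_roundLaw D hk (hpos x)
  have hmixm : ∀ s, Measurable fun x => mixture D (w x) s := by
    intro s
    simp only [mixture, Measure.coe_finsetSum, Finset.sum_apply, Measure.smul_apply, smul_eq_mul]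
    have hwi : ∀ i, Measurable fun x => w x i := fun i => (measurable_pi_apply i).comp hw
    exact Finset.measurable_sum _ fun i _ => (((hwi i).div
      (Finset.measurable_sum _ fun j _ => hwi j)).ennreal_ofReal).mul_const _
  have hpi : Measurable fun x => Measure.pi fun _ : Fin mS => mixture D (w x) := by
    refine Measurable.measure_of_isPiSystem_of_isProbabilityMeasure generateFrom_pi.symm
      isPiSystem_pi ?_
    rintro _ ⟨s, -, rfl⟩
    simp_rw [Measure.pi_pi]
    exact Finset.measurable_prod _ fun j _ => hmixm _
  refine Measurable.measure_of_isPiSystem_of_isProbabilityMeasure generateFrom_prod.symm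
    isPiSystem_prod ?_
  rintro _ ⟨s, hs : MeasurableSet s, t, -, rfl⟩
  simp_rw [roundLaw, Measure.prod_prod]
  exact ((Measure.measurable_coe hs).comp hpi).mul_const _

variable {ε α : ℝ} {O : (Fin mS → X × Bool) → X → Bool}

/-- `Measure.bind` along a map that is not a.e. measurable takes the default value `0`; this lemma
is what makes `law` the law of the process. -/
lemma measurable_map_snoc (hk : 0 < k) (hε : 0 < ε) (hα : 0 < α)
    (hO : Measurable fun p : (Fin mS → X × Bool) × X => O p.1 p.2) (r : ℕ) :
    Measurable fun h : Fin r → Round X k mS mT => (roundLaw D (weights ε α O r h)).map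
      fun z => (Fin.snoc (α := fun _ => Round X k mS mT) h z : Fin (r + 1) → Round X k mS mT) := by
  have hm : Measurable fun h : Fin r → Round X k mS mT =>
      (roundLaw D (weights ε α O r h) : Measure (Round X k mS mT)) :=
    measurable_roundLaw D hk (measurable_weights ε α hO r) (weights_pos hε hα O r)
  let κ : Kernel (Fin r → Round X k mS mT) (Round X k mS mT) :=
    ⟨fun h => roundLaw D (weights ε α O r h), hm⟩
  have : IsMarkovKernel κ := ⟨fun h => isProbabilityMeasure_roundLaw D hk (weights_pos hε hα O r h)⟩
  refine Measure.measurable_of_measurable_coe _ fun s hs => ?_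
  have hsn : ∀ h : Fin r → Round X k mS mT, Measurable fun z =>
      (Fin.snoc (α := fun _ => Round X k mS mT) h z : Fin (r + 1) → Round X k mS mT) :=
    fun h => measurable_snoc.comp (measurable_const.prodMk measurable_id)
  simp_rw [Measure.map_apply (hsn _) hs]
  exact Kernel.measurable_kernel_prodMk_left (κ := κ) (measurable_snoc hs)

lemma lintegral_law_succ (hk : 0 < k) (hε : 0 < ε) (hα : 0 < α)
    (hO : Measurable fun p : (Fin mS → X × Bool) × X => O p.1 p.2) (r : ℕ)
    {f : (Fin (r + 1) → Round X k mS mT) → ENNReal} (hf : Measurable f) :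
    ∫⁻ h, f h ∂law ε α D O (r + 1) = ∫⁻ h, ∫⁻ z, f (Fin.snoc (α := fun _ => Round X k mS mT) h z)
      ∂roundLaw D (weights ε α O r h) ∂law ε α D O r := by
  rw [law, Measure.lintegral_bind (measurable_map_snoc D hk hε hα hO r).aemeasurable
    hf.aemeasurable]
  refine lintegral_congr fun h => ?_
  have hsn : Measurable fun z =>
      (Fin.snoc (α := fun _ => Round X k mS mT) h z : Fin (r + 1) → Round X k mS mT) :=
    measurable_snoc.comp (measurable_const.prodMk measurable_id)
  rw [lintegral_map hf hsn]

lemma isProbabilityMeasure_law (hk : 0 < k) (hε : 0 < ε) (hα : 0 < α)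
    (hO : Measurable fun p : (Fin mS → X × Bool) × X => O p.1 p.2) (r : ℕ) :
    IsProbabilityMeasure (law (mT := mT) ε α D O r) := by
  induction r with
  | zero => rw [law]; infer_instance
  | succ r ih =>
    constructor
    have hr : ∀ h : Fin r → Round X k mS mT,
        IsProbabilityMeasure (roundLaw D (weights ε α O r h) : Measure (Round X k mS mT)) :=
      fun h => isProbabilityMeasure_roundLaw D hk (weights_pos hε hα O r h)
    rw [← lintegral_one, lintegral_law_succ D hk hε hα hO r measurable_const]
    simp

/-- A nonnegative supermartingale along the rounds of the algorithm. -/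
lemma lintegral_law_le_of_supermartingale (hk : 0 < k) (hε : 0 < ε) (hα : 0 < α)
    (hO : Measurable fun p : (Fin mS → X × Bool) × X => O p.1 p.2)
    {J : (r : ℕ) → (Fin r → Round X k mS mT) → ENNReal} (hJ : ∀ r, Measurable (J r))
    (hsuper : ∀ r h, ∫⁻ z, J (r + 1) (Fin.snoc (α := fun _ => Round X k mS mT) h z)
      ∂roundLaw D (weights ε α O r h) ≤ J r h) (r : ℕ) :
    ∫⁻ h, J r h ∂law ε α D O r ≤ J 0 Fin.elim0 := by
  induction r with
  | zero => rw [law, lintegral_dirac' _ (hJ 0)]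
  | succ r ih =>
    rw [lintegral_law_succ D hk hε hα hO r (hJ (r + 1))]
    exact (lintegral_mono (hsuper r)).trans ih

/-- A union bound over the rounds of the algorithm. -/
lemma law_not_allRounds_le (hk : 0 < k) (hε : 0 < ε) (hα : 0 < α)
    (hO : Measurable fun p : (Fin mS → X × Bool) × X => O p.1 p.2)
    {good : (Fin k → ℝ) → (Fin mS → X × Bool) → Prop}
    (hgood : MeasurableSet {p : (Fin k → ℝ) × (Fin mS → X × Bool) | good p.1 p.2}) {β : ENNReal}
    (hβ : ∀ w : Fin k → ℝ, (∀ i, 0 < w i) →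
      (Measure.pi fun _ : Fin mS => mixture D w) {S | ¬ good w S} ≤ β) (r : ℕ) :
    law (mT := mT) ε α D O r {h | ¬ AllRounds ε α O good r h} ≤ r * β := by
  induction r with
  | zero => simp [AllRounds]
  | succ r ih =>
    have hs : MeasurableSet {h : Fin (r + 1) → Round X k mS mT |
        ¬ AllRounds ε α O good (r + 1) h} := (measurableSet_allRounds ε α hO hgood (r + 1)).compl
    have hs' : MeasurableSet {h : Fin r → Round X k mS mT |
        ¬ AllRounds ε α O good r h} := (measurableSet_allRounds ε α hO hgood r).compl
    have := isProbabilityMeasure_law (mT := mT) D hk hε hα hO r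
    rw [← lintegral_indicator_one hs,
      lintegral_law_succ D hk hε hα hO r (measurable_one.indicator hs)]
    calc _ ≤ ∫⁻ h, ({h | ¬ AllRounds ε α O good r h}.indicator 1 h + β) ∂law ε α D O r := by
          refine lintegral_mono fun h => ?_
          have hw := weights_pos hε hα O r h
          have := isProbabilityMeasure_mixture hk D hw
          have := isProbabilityMeasure_roundLaw (mS := mS) (mT := mT) D hk hw
          -- A history that is good so far can fail only in the new round, at cost `β`; one that has
          -- failed is already counted by the indicator.
          by_cases hh : AllRounds ε α O good r h
          · have hgw : MeasurableSet {S | ¬ good (weights ε α O r h) S} :=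
              ((measurable_const.prodMk measurable_id) hgood).compl
            have hset : ∀ z : Round X k mS mT, ({h | ¬ AllRounds ε α O good (r + 1) h}.indicator 1
                (Fin.snoc (α := fun _ => Round X k mS mT) h z) : ENNReal) =
                (Prod.fst ⁻¹' {S | ¬ good (weights ε α O r h) S}).indicator 1 z := by
              intro z
              have hiff : AllRounds ε α O good (r + 1)
                  (Fin.snoc (α := fun _ => Round X k mS mT) h z) ↔
                  good (weights ε α O r h) z.1 := by rw [allRounds_snoc]; simp [hh]
              by_cases hz : good (weights ε α O r h) z.1
              · have := hiff.2 hz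
                simp [Set.indicator, this, hz]
              · have := mt hiff.1 hz
                simp [Set.indicator, this, hz]
            simp_rw [hset]
            rw [lintegral_indicator_one (measurable_fst hgw)]
            refine le_trans (le_of_eq ?_) ((hβ _ hw).trans le_add_self)
            rw [roundLaw, ← Set.prod_univ, Measure.prod_prod, measure_univ, mul_one]
          · refine le_trans ?_ (le_self_add)
            have h1 : ({h | ¬ AllRounds ε α O good r h}.indicator 1 h : ENNReal) = 1 := by
              simp [Set.indicator, hh]
            rw [h1]
            refine (lintegral_mono fun z => Set.indicator_le_self _ _ _).trans ?_
            simp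
      _ ≤ (r + 1 : ℕ) * β := by
          rw [lintegral_add_right _ measurable_const, lintegral_indicator_one hs', lintegral_const,
            measure_univ, mul_one]
          push_cast
          rw [add_mul, one_mul]
          gcongr

end Rounds

/-! ### The potential of a player and its change in one round. -/

section Potential

variable {X : Type*} {k mS mT : ℕ}

/-- The normalization of the steps of a round. -/
noncomputable def den {n : ℕ} (a e : ℝ) (S : Fin n → X × Bool) (f : X → Bool) : ℝ :=
  (1 + 3 * a) * empErr S f + 3 * e

lemma three_mul_le_den {n : ℕ} {a e : ℝ} (ha : 0 < a) (S : Fin n → X × Bool) (f : X → Bool) :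
    3 * e ≤ den a e S f := by
  have := empErr_nonneg S f
  unfold den
  nlinarith

lemma den_pos {n : ℕ} {a e : ℝ} (ha : 0 < a) (he : 0 < e) (S : Fin n → X × Bool) (f : X → Bool) :
    0 < den a e S f :=
  lt_of_lt_of_le (by positivity) (three_mul_le_den ha S f)

/-- Since `log (1 + s) ≥ 2 * s / (s + 2)`, the relative loss is at most `s / 2`, hence at most `a /
6`. -/
lemma mul_le_log_one_add {a s : ℝ} (hs : 0 ≤ s) (hsa : s ≤ a / 3) :
    (1 - a / 6) * s ≤ Real.log (1 + s) := by
  refine le_trans ?_ (Real.le_log_one_add_of_nonneg hs)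
  rw [le_div_iff₀ (by linarith)]
  nlinarith [mul_nonneg hs hs]

lemma step_eq (ε α : ℝ) (O : (Fin mS → X × Bool) → X → Bool) (z : Round X k mS mT) (i : Fin k) :
    step ε α O z i = eps' ε * alpha' α *
      (empErr (z.2 i) (O z.1) / den (alpha' α) (eps' ε) z.1 (O z.1)) := by
  unfold step den
  ring

variable [MeasurableSpace X]

/-- The increment of the potential in a round with weights `w`. -/
noncomputable def increment (a e : ℝ) (D : Fin k → Measure (X × Bool))
    (O : (Fin mS → X × Bool) → X → Bool) (i : Fin k) (w : Fin k → ℝ) (z : Round X k mS mT) : ℝ :=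
  ∑ l, w l / (∑ j, w j) * (empErr (z.2 l) (O z.1) / den a e z.1 (O z.1)) -
    (1 - a / 6) * (empErr (z.2 i) (O z.1) / den a e z.1 (O z.1)) +
    (1 - a / 3) * (err (D i) (O z.1) / den a e z.1 (O z.1)) - 1

/-- The potential of player `i` after `r` rounds. -/
noncomputable def potential (ε α : ℝ) (D : Fin k → Measure (X × Bool))
    (O : (Fin mS → X × Bool) → X → Bool) (i : Fin k) (r : ℕ) (h : Fin r → Round X k mS mT) : ℝ :=
  Real.log (∑ l, weights ε α O r h l) - Real.log (weights ε α O r h i) +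
    eps' ε * alpha' α * ((1 - alpha' α / 3) * ∑ j : Fin r, err (D i) (O (h j).1) /
      den (alpha' α) (eps' ε) (h j).1 (O (h j).1) - r)

lemma potential_zero (ε α : ℝ) (D : Fin k → Measure (X × Bool))
    (O : (Fin mS → X × Bool) → X → Bool) (i : Fin k) (h : Fin 0 → Round X k mS mT) :
    potential ε α D O i 0 h = Real.log k := by
  simp [potential, weights]

/-- A single weight is at most the sum of all weights, so the logarithmic part of the potential is
nonnegative. -/
lemma potential_ge {ε α : ℝ} (hε : 0 < ε) (hα : 0 < α) (D : Fin k → Measure (X × Bool))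
    (O : (Fin mS → X × Bool) → X → Bool) (i : Fin k) (r : ℕ) (h : Fin r → Round X k mS mT) :
    eps' ε * alpha' α * ((1 - alpha' α / 3) * ∑ j : Fin r, err (D i) (O (h j).1) /
      den (alpha' α) (eps' ε) (h j).1 (O (h j).1) - r) ≤ potential ε α D O i r h := by
  have hpos := weights_pos hε hα O r h
  have := Real.log_le_log (hpos i)
    (Finset.single_le_sum (f := weights ε α O r h) (fun l _ => (hpos l).le) (Finset.mem_univ i))
  unfold potential
  linarith

/-- The sum of the weights is multiplied by `1` plus the weighted mean of the steps, and `log (1 +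
x) ≤ x`. For player `i` the opposite inequality `mul_le_log_one_add` is used; it needs `s_i ≤ a /
3`, which holds because the normalization is at least `3e` and empirical errors are at most `1`. -/
lemma potential_snoc_le {ε α : ℝ} (hε : 0 < ε) (hα : 0 < α)
    (D : Fin k → Measure (X × Bool)) (O : (Fin mS → X × Bool) → X → Bool) (i : Fin k) (r : ℕ)
    (h : Fin r → Round X k mS mT) (z : Round X k mS mT) :
    potential ε α D O i (r + 1) (Fin.snoc (α := fun _ => Round X k mS mT) h z) ≤
      potential ε α D O i r h + eps' ε * alpha' α *
        increment (alpha' α) (eps' ε) D O i (weights ε α O r h) z := by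
  have he : 0 < eps' ε := by unfold eps'; positivity
  have ha : 0 < alpha' α := by unfold alpha'; positivity
  have hpos := weights_pos hε hα O r h
  have hsum : 0 < ∑ l, weights ε α O r h l :=
    Finset.sum_pos (fun l _ => hpos l) ⟨i, Finset.mem_univ i⟩
  have hs0 := step_nonneg hε hα O z
  have hsa : step ε α O z i ≤ alpha' α / 3 := by
    rw [step_eq, mul_div_assoc', div_le_iff₀ (den_pos ha he _ _)]
    have h1 := empErr_le_one (z.2 i) (O z.1)
    have h2 := three_mul_le_den (e := eps' ε) ha z.1 (O z.1)
    have h3 := mul_le_mul_of_nonneg_left h1 (mul_pos he ha).le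
    nlinarith
  set w := weights ε α O r h with hw
  have htot : ∑ l, w l * (1 + step ε α O z l) =
      (∑ l, w l) * (1 + ∑ l, w l / (∑ j, w j) * step ε α O z l) := by
    rw [mul_add, mul_one, Finset.mul_sum, ← Finset.sum_add_distrib]
    refine Finset.sum_congr rfl fun l _ => ?_
    field_simp
  have hps : 0 ≤ ∑ l, w l / (∑ j, w j) * step ε α O z l :=
    Finset.sum_nonneg fun l _ => mul_nonneg (div_nonneg (hpos l).le hsum.le) (hs0 l)
  have hlog1 : Real.log (∑ l, w l * (1 + step ε α O z l)) ≤
      Real.log (∑ l, w l) + ∑ l, w l / (∑ j, w j) * step ε α O z l := by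
    rw [htot, Real.log_mul hsum.ne' (by linarith)]
    have := Real.log_le_sub_one_of_pos (show 0 < 1 + ∑ l, w l / (∑ j, w j) * step ε α O z l by
      linarith)
    linarith
  have hlog2 : Real.log (w i) + (1 - alpha' α / 6) * step ε α O z i ≤
      Real.log (w i * (1 + step ε α O z i)) := by
    rw [Real.log_mul (hpos i).ne' (by linarith [hs0 i])]
    linarith [mul_le_log_one_add (hs0 i) hsa]
  have hsteps : ∑ l, w l / (∑ j, w j) * step ε α O z l = eps' ε * alpha' α *
      ∑ l, w l / (∑ j, w j) *
        (empErr (z.2 l) (O z.1) / den (alpha' α) (eps' ε) z.1 (O z.1)) := by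
    rw [Finset.mul_sum]
    refine Finset.sum_congr rfl fun l _ => ?_
    rw [step_eq]
    ring
  rw [hsteps] at hlog1
  rw [step_eq] at hlog2
  unfold potential increment
  simp_rw [weights_snoc, ← hw]
  rw [Fin.sum_univ_castSucc]
  simp only [Fin.snoc_castSucc, Fin.snoc_last]
  rw [step_eq ε α O z i]
  push_cast
  linarith

/-- The condition on a round under which the potential is a supermartingale. -/
def GoodRound (a e B : ℝ) (D : Fin k → Measure (X × Bool)) (O : (Fin mS → X × Bool) → X → Bool)
    (w : Fin k → ℝ) (S : Fin mS → X × Bool) : Prop :=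
  mixErr D w (O S) ≤ (1 + a) * empErr S (O S) + e ∧ empErr S (O S) ≤ B

/-- The exponential moment of the increment over the samples from the players. -/
lemma lintegral_exp_increment_le {a e B : ℝ} (ha : 0 < a) (ha1 : a ≤ 1) (he : 0 < e) (hk : 0 < k)
    (D : Fin k → Measure (X × Bool)) [∀ i, IsProbabilityMeasure (D i)]
    {O : (Fin mS → X × Bool) → X → Bool} (i : Fin k) {w : Fin k → ℝ} (hw : ∀ i, 0 < w i)
    {S : Fin mS → X × Bool} (hf : Measurable (O S)) (hS : GoodRound a e B D O w S) :
    ∫⁻ T, ENNReal.ofReal (Real.exp (mT / 2 * (e * a * increment a e D O i w (S, T))))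
      ∂(Measure.pi fun i => Measure.pi fun _ : Fin mT => D i) ≤ 1 := by
  classical
  set f := O S with hfdef
  set q := den a e S f with hq
  have hqpos : 0 < q := den_pos ha he S f
  have hsum : 0 < ∑ l, w l := Finset.sum_pos (fun l _ => hw l) ⟨i, Finset.mem_univ i⟩
  set p : Fin k → ℝ := fun l => w l / ∑ j, w j with hp
  have hp0 : ∀ l, 0 ≤ p l := fun l => (div_pos (hw l) hsum).le
  have hp1 : ∀ l, p l ≤ 1 := fun l => by
    rw [← sum_div_sum_eq_one hk hw]
    exact Finset.single_le_sum (f := p) (fun l _ => hp0 l) (Finset.mem_univ l)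
  -- The exponent is linear in the numbers of mistakes, with coefficients `b l` of order `lam`. The
  -- factor `1 / 2` in `mT / 2`, together with `q ≥ 3e`, gives `lam ≤ a / 6`, which keeps the
  -- squares `b l ^ 2` of relative size `a / 6`.
  set lam : ℝ := e * a / (2 * q) with hlam
  have hlam0 : 0 < lam := by positivity
  have hlam1 : lam ≤ a / 6 := by
    rw [hlam, div_le_iff₀ (by positivity)]
    have := three_mul_le_den (e := e) ha S f
    nlinarith
  set c : ℝ := 1 - a / 6 with hc
  set b : Fin k → ℝ := fun l => lam * (p l - if l = i then c else 0) with hb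
  have hb1 : ∀ l, |b l| ≤ 1 := by
    intro l
    have h1 := hp0 l
    have h2 := hp1 l
    simp only [hb, abs_le]
    split_ifs <;> constructor <;> nlinarith
  have hexp : ∀ T : Fin k → Fin mT → X × Bool,
      mT / 2 * (e * a * increment a e D O i w (S, T)) =
      (mT * lam * ((1 - a / 3) * err (D i) f - q)) + ∑ l, b l * (mT * empErr (T l) f) := by
    intro T
    have h1 : ∑ l, b l * (mT * empErr (T l) f) =
        mT * lam * (∑ l, p l * empErr (T l) f - c * empErr (T i) f) := by
      have h2 : ∀ l, b l * (mT * empErr (T l) f) = mT * lam * (p l * empErr (T l) f) -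
          mT * lam * (if l = i then c * empErr (T l) f else 0) := by
        intro l
        simp only [hb]
        split_ifs <;> ring
      simp_rw [h2]
      rw [Finset.sum_sub_distrib, ← Finset.mul_sum, ← Finset.mul_sum]
      simp only [Finset.sum_ite_eq', Finset.mem_univ, if_true]
      ring
    have h3 : ∑ l, w l / (∑ j, w j) * (empErr (T l) f / q) =
        (∑ l, p l * empErr (T l) f) / q := by
      rw [Finset.sum_div]
      exact Finset.sum_congr rfl fun l _ => by rw [hp, mul_div_assoc]
    rw [h1]
    unfold increment
    simp only [← hfdef, ← hq]
    rw [h3, hlam]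
    field_simp
    ring
  simp_rw [hexp]
  simp_rw [Real.exp_add, ENNReal.ofReal_mul (Real.exp_pos _).le]
  rw [lintegral_const_mul' _ _ ENNReal.ofReal_ne_top]
  refine (mul_le_mul_right (lintegral_exp_players_le D hf hb1) _).trans ?_
  rw [← ENNReal.ofReal_mul (Real.exp_pos _).le, ← Real.exp_add, ← ENNReal.ofReal_one]
  refine ENNReal.ofReal_le_ofReal (Real.exp_le_one_iff.2 ?_)
  -- The square costs `lam * (a / 6)` on `p l` and again on the term of player `i`. This turns `1 -
  -- a / 6` into the `1 - a / 3` built into the potential, so that the errors of player `i` cancel.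
  have hbl : ∀ l, err (D l) f * (b l + b l ^ 2) ≤
      lam * (1 + a / 6) * (p l * err (D l) f) -
        lam * (if l = i then (1 - a / 3) * err (D l) f else 0) := by
    intro l
    have h0 := err_nonneg (D l) f
    have h1 := hp0 l
    have h2 := hp1 l
    have hll : lam ^ 2 ≤ lam * (a / 6) := by rw [sq]; exact mul_le_mul_of_nonneg_left hlam1 hlam0.le
    have hdiff : b l + b l ^ 2 ≤
        lam * (1 + a / 6) * p l - lam * (if l = i then 1 - a / 3 else 0) := by
      simp only [hb]
      split_ifs
      · have hsq : (p l - c) ^ 2 ≤ p l + 1 := by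
          have : 0 ≤ c := by rw [hc]; linarith
          have : c ≤ 1 := by rw [hc]; linarith
          nlinarith
        have : lam ^ 2 * (p l - c) ^ 2 ≤ lam * (a / 6) * (p l + 1) := by gcongr
        rw [hc] at *
        nlinarith
      · have hsq : p l ^ 2 ≤ p l := by nlinarith
        have : lam ^ 2 * p l ^ 2 ≤ lam * (a / 6) * p l := by gcongr
        nlinarith
    refine (mul_le_mul_of_nonneg_left hdiff h0).trans (le_of_eq ?_)
    split_ifs <;> ring
  have hsumle : ∑ l, err (D l) f * (b l + b l ^ 2) ≤
      lam * ((1 + a / 6) * mixErr D w f - (1 - a / 3) * err (D i) f) := by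
    refine (Finset.sum_le_sum fun l _ => hbl l).trans (le_of_eq ?_)
    rw [Finset.sum_sub_distrib, ← Finset.mul_sum, ← Finset.mul_sum]
    simp only [Finset.sum_ite_eq', Finset.mem_univ, if_true, mixErr]
    ring
  -- Goodness and `(1 + a / 6) * (1 + a) ≤ 1 + 3 * a`: this is why the normalization has the factor
  -- `1 + 3a`.
  have hmix : (1 + a / 6) * mixErr D w f ≤ q := by
    have h1 := hS.1
    have h2 := empErr_nonneg S f
    rw [← hfdef] at h1
    rw [hq, den]
    have h3 := mul_le_mul_of_nonneg_left h1 (show 0 ≤ 1 + a / 6 by positivity)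
    refine h3.trans ?_
    have h4 : (1 + a / 6) * (1 + a) ≤ 1 + 3 * a := by nlinarith
    have h5 := mul_le_mul_of_nonneg_right h4 h2
    nlinarith
  have hm : (0 : ℝ) ≤ mT := Nat.cast_nonneg _
  have h6 := mul_le_mul_of_nonneg_left hsumle hm
  have h7 := mul_le_mul_of_nonneg_left hmix (mul_nonneg hm hlam0.le)
  nlinarith

end Potential

/-! ### Tail bounds: large potentials and bad rounds. -/

section Tail

variable {X : Type*} {k mS mT : ℕ} [MeasurableSpace X]
  (D : Fin k → Measure (X × Bool)) [∀ i, IsProbabilityMeasure (D i)]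
  {O : (Fin mS → X × Bool) → X → Bool}

lemma measurableSet_goodRound (a e B : ℝ)
    (hO : Measurable fun p : (Fin mS → X × Bool) × X => O p.1 p.2) :
    MeasurableSet {p : (Fin k → ℝ) × (Fin mS → X × Bool) | GoodRound a e B D O p.1 p.2} := by
  have hw : ∀ i, Measurable fun p : (Fin k → ℝ) × (Fin mS → X × Bool) => p.1 i := fun i =>
    (measurable_pi_apply i).comp measurable_fst
  have hE : Measurable fun p : (Fin k → ℝ) × (Fin mS → X × Bool) => empErr p.2 (O p.2) :=
    (measurable_empErr_comp hO measurable_id).comp measurable_snd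
  have hM : Measurable fun p : (Fin k → ℝ) × (Fin mS → X × Bool) => mixErr D p.1 (O p.2) := by
    refine Finset.measurable_sum _ fun i _ => Measurable.mul ?_ ?_
    · exact (hw i).div (Finset.measurable_sum _ fun j _ => hw j)
    · exact (measurable_err_comp hO (D i)).comp measurable_snd
  exact (measurableSet_le hM ((hE.const_mul _).add_const _)).inter
    (measurableSet_le hE measurable_const)

lemma measurable_potential (ε α : ℝ)
    (hO : Measurable fun p : (Fin mS → X × Bool) × X => O p.1 p.2) (i : Fin k) (r : ℕ) :
    Measurable fun h : Fin r → Round X k mS mT => potential ε α D O i r h := by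
  have hw : ∀ l, Measurable fun h : Fin r → Round X k mS mT => weights ε α O r h l := fun l =>
    (measurable_pi_apply l).comp (measurable_weights ε α hO r)
  have hj : ∀ j, Measurable fun h : Fin r → Round X k mS mT => (h j).1 := fun j =>
    measurable_fst.comp (measurable_pi_apply j)
  have hden : Measurable fun S : Fin mS → X × Bool => den (alpha' α) (eps' ε) S (O S) :=
    ((measurable_empErr_comp hO measurable_id).const_mul _).add_const _
  have hq : ∀ j : Fin r, Measurable fun h : Fin r → Round X k mS mT =>
      err (D i) (O (h j).1) / den (alpha' α) (eps' ε) (h j).1 (O (h j).1) := fun j =>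
    ((measurable_err_comp hO (D i)).div hden).comp (hj j)
  exact ((Finset.measurable_sum _ fun l _ => hw l).log.sub (hw i).log).add
    ((((Finset.measurable_sum _ fun j _ => hq j).const_mul _).sub_const _).const_mul _)

variable {ε α : ℝ}

/-- The potential of a player is large with small probability. -/
theorem law_potential_ge_le (hk : 0 < k) (hε : 0 < ε) (hα : 0 < α) (hα1 : α < 1)
    (hO : Measurable fun p : (Fin mS → X × Bool) × X => O p.1 p.2) (B : ℝ) (i : Fin k) (r : ℕ)
    (c : ℝ) :
    law (mT := mT) ε α D O r {h |
      AllRounds ε α O (GoodRound (alpha' α) (eps' ε) B D O) r h ∧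
        mT / 2 * Real.log k + c ≤ mT / 2 * potential ε α D O i r h} ≤
      ENNReal.ofReal (Real.exp (-c)) := by
  have he : 0 < eps' ε := by unfold eps'; positivity
  have ha : 0 < alpha' α := by unfold alpha'; positivity
  have ha1 : alpha' α ≤ 1 := by unfold alpha'; linarith
  set good := GoodRound (alpha' α) (eps' ε) B D O with hgood
  let E : (r : ℕ) → (Fin r → Round X k mS mT) → ENNReal := fun r h =>
    ENNReal.ofReal (Real.exp (mT / 2 * potential ε α D O i r h))
  have hE : ∀ r, Measurable (E r) := fun r =>
    (Real.measurable_exp.comp ((measurable_potential D ε α hO i r).const_mul _)).ennreal_ofReal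
  -- The process is killed at the first bad round, since its drift is controlled only in good ones.
  let J : (r : ℕ) → (Fin r → Round X k mS mT) → ENNReal := fun r =>
    {h | AllRounds ε α O good r h}.indicator (E r)
  have hJ : ∀ r, Measurable (J r) := fun r =>
    (hE r).indicator (measurableSet_allRounds ε α hO (measurableSet_goodRound D _ _ B hO) r)
  have hOS : ∀ S, Measurable (O S) := fun S => hO.comp (measurable_const.prodMk measurable_id)
  have hsuper : ∀ r h, ∫⁻ z, J (r + 1) (Fin.snoc (α := fun _ => Round X k mS mT) h z)
      ∂roundLaw D (weights ε α O r h) ≤ J r h := by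
    intro r h
    have hw := weights_pos hε hα O r h
    have := isProbabilityMeasure_mixture hk D hw
    by_cases hh : AllRounds ε α O good r h
    · let I : Round X k mS mT → ENNReal := {z | good (weights ε α O r h) z.1}.indicator fun z =>
        ENNReal.ofReal (Real.exp (mT / 2 * (eps' ε * alpha' α *
          increment (alpha' α) (eps' ε) D O i (weights ε α O r h) z)))
      have hle : ∀ z, J (r + 1) (Fin.snoc (α := fun _ => Round X k mS mT) h z) ≤ E r h * I z := by
        intro z
        by_cases hz : good (weights ε α O r h) z.1
        · have hI : I z = ENNReal.ofReal (Real.exp (mT / 2 * (eps' ε * alpha' α *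
            increment (alpha' α) (eps' ε) D O i (weights ε α O r h) z))) :=
            Set.indicator_of_mem (s := {z : Round X k mS mT | good (weights ε α O r h) z.1}) hz _
          refine (Set.indicator_le_self _ _ _).trans ?_
          rw [hI, ← ENNReal.ofReal_mul (Real.exp_pos _).le, ← Real.exp_add, ← mul_add]
          refine ENNReal.ofReal_le_ofReal (Real.exp_le_exp.2 ?_)
          exact mul_le_mul_of_nonneg_left (potential_snoc_le hε hα D O i r h z) (by positivity)
        · have hn : ¬ AllRounds ε α O good (r + 1)
              (Fin.snoc (α := fun _ => Round X k mS mT) h z) := fun hn =>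
            hz (allRounds_snoc.1 hn).2
          exact (Set.indicator_of_notMem (s := {h | AllRounds ε α O good (r + 1) h}) hn _).trans_le
            zero_le
      have hJh : J r h = E r h :=
        Set.indicator_of_mem (s := {h | AllRounds ε α O good r h}) hh _
      rw [hJh]
      refine (lintegral_mono hle).trans ?_
      rw [lintegral_const_mul' _ _ ENNReal.ofReal_ne_top]
      refine mul_le_of_le_one_right' ?_
      rw [roundLaw]
      -- The players' samples are integrated first, with `S` fixed: goodness and the classifier
      -- depend on `S` alone.
      refine (lintegral_prod_le _).trans ?_
      calc _ ≤ ∫⁻ _S, 1 ∂(Measure.pi fun _ : Fin mS => mixture D (weights ε α O r h)) := by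
            refine lintegral_mono fun S => ?_
            by_cases hS : good (weights ε α O r h) S
            · refine (lintegral_mono fun T => Set.indicator_le_self _ _ _).trans ?_
              exact lintegral_exp_increment_le ha ha1 he hk D i hw (hOS S) hS
            · have : ∀ T, I (S, T) = 0 := fun T =>
                Set.indicator_of_notMem
                  (s := {z : Round X k mS mT | good (weights ε α O r h) z.1}) hS _
              simp only [this]
              simp
        _ = 1 := by simp
    · have hn : ∀ z, J (r + 1) (Fin.snoc (α := fun _ => Round X k mS mT) h z) = 0 := fun z =>
        Set.indicator_of_notMem (s := {h | AllRounds ε α O good (r + 1) h})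
          (fun hn => hh (allRounds_snoc.1 hn).1) _
      simp [hn]
  have htot := lintegral_law_le_of_supermartingale D hk hε hα hO hJ hsuper r
  have h0 : J 0 Fin.elim0 ≤ ENNReal.ofReal (Real.exp (mT / 2 * Real.log k)) := by
    refine (Set.indicator_le_self _ _ _).trans ?_
    simp only [E, potential_zero]
    exact le_rfl
  have hmark := mul_meas_ge_le_lintegral₀ (μ := law (mT := mT) ε α D O r) (hJ r).aemeasurable
    (ENNReal.ofReal (Real.exp (mT / 2 * Real.log k + c)))
  have hfin := hmark.trans (htot.trans h0)
  have hsub : {h | AllRounds ε α O good r h ∧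
      mT / 2 * Real.log k + c ≤ mT / 2 * potential ε α D O i r h} ⊆
      {h | ENNReal.ofReal (Real.exp (mT / 2 * Real.log k + c)) ≤ J r h} := by
    rintro h ⟨hh, hc⟩
    have hJh : J r h = E r h :=
      Set.indicator_of_mem (s := {h | AllRounds ε α O good r h}) hh _
    change _ ≤ J r h
    rw [hJh]
    exact ENNReal.ofReal_le_ofReal (Real.exp_le_exp.2 hc)
  refine (measure_mono hsub).trans ?_
  generalize law ε α D O r
    {h | ENNReal.ofReal (Real.exp (mT / 2 * Real.log k + c)) ≤ J r h} = p at hfin ⊢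
  rw [Real.exp_add, ENNReal.ofReal_mul (Real.exp_pos _).le, mul_assoc] at hfin
  have hcancel := (ENNReal.mul_le_mul_iff_right (by simp [Real.exp_pos]) ENNReal.ofReal_ne_top).1
    (hfin.trans_eq (mul_one _).symm)
  rw [Real.exp_neg, ENNReal.ofReal_inv_of_pos (Real.exp_pos _), ← one_div,
    ENNReal.le_div_iff_mul_le (by simp [Real.exp_pos]) (by simp), mul_comm]
  exact hcancel

/-- A round is good with high probability. -/
theorem measure_not_goodRound_le (hk : 0 < k) (hmS : 0 < mS) {F : Set (X → Bool)} {d : ℕ}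
    (hF : HasVCDim F d) {a e : ℝ} (ha : 0 < a) (ha1 : a ≤ 1) (he : 0 < e) (he1 : e ≤ 1)
    (hO : IsERM F e O) {f : X → Bool} (hfF : f ∈ F) (hf : Measurable f) {b : ℝ}
    (hb : ∀ i, err (D i) f ≤ b) {w : Fin k → ℝ} (hw : ∀ i, 0 < w i) :
    (Measure.pi fun _ : Fin mS => mixture D w)
      {S | ¬ GoodRound a e ((1 + a) * b + 2 * e) D O w S} ≤
      ENNReal.ofReal ((24 / (a * e)) ^ d * Real.exp (-(a * e / 12 * mS))) +
        ENNReal.ofReal (Real.exp (-(a * e * mS))) := by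
  have := isProbabilityMeasure_mixture hk D hw
  refine le_trans ?_ (add_le_add
    (measure_overfit_le hF hmS ha ha1 he he1 (mixture D w) hO.measurable hO.mem)
    (measure_empErr_gt_le (e := e) hmS ha ha1 (mixture D w) hf))
  refine (measure_mono fun S hS => ?_).trans (measure_union_le _ _)
  by_contra hn
  simp only [Set.mem_union, not_or, Set.mem_ofPred_eq, not_not] at hn
  refine hS ⟨?_, ?_⟩
  · rw [← err_mixture D hw]
    exact hn.1
  -- The fixed comparator `f` has empirical error at most `(1 + a) * b + e`, and the oracle loses at
  -- most another `e`. No uniformity over `F` is needed here.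
  · have h1 := hn.2
    rw [err_mixture D hw] at h1
    have h2 := mixErr_le hk hw hb
    have h3 : (⨅ g : F, empErr S g) ≤ empErr S f :=
      ciInf_le (f := fun g : F => empErr S g) ⟨0, by
        rintro _ ⟨g, rfl⟩
        exact empErr_nonneg S g⟩ ⟨f, hfF⟩
    have h4 := hO.empErr_le S
    have h5 := mul_le_mul_of_nonneg_left h2 (show 0 ≤ 1 + a by linarith)
    linarith

end Tail

/-! ### The returned classifier, near-optimal members of the class, and dimension zero. -/

section Output

variable {X : Type*} {k mS mT : ℕ} [MeasurableSpace X]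

lemma expErr_output {t : ℕ} (ht : 0 < t) (D : Measure (X × Bool)) [IsProbabilityMeasure D]
    {O : (Fin mS → X × Bool) → X → Bool} (hO : ∀ S, Measurable (O S))
    (h : Fin t → Round X k mS mT) :
    expErr D (output O h) = (∑ r, err D (O (h r).1)) / t := by
  classical
  have : NeZero t := ⟨ht.ne'⟩
  have hpt : ∀ z : X × Bool, (output O h z.1).real {b | b ≠ z.2} =
      (∑ r, ({z | O (h r).1 z.1 ≠ z.2} : Set (X × Bool)).indicator (fun _ => (1 : ℝ)) z) / t := by
    intro z
    rw [output, uniformClassifier, Measure.real, Measure.map_apply (measurable_of_finite _)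
      (Set.toFinite _).measurableSet, uniformOn_univ, ENNReal.toReal_div]
    congr 1
    · rw [Measure.count_apply (Set.toFinite _).measurableSet, Set.encard_eq_coe_toFinset_card]
      simp only [Set.indicator, Set.mem_ofPred_eq]
      rw [Finset.sum_boole]
      simp
    · simp
  have hms : ∀ r, MeasurableSet {z : X × Bool | O (h r).1 z.1 ≠ z.2} := by
    intro r
    have := measurable_loss (hO (h r).1) (measurableSet_singleton true)
    simpa only [Set.preimage, Set.mem_singleton_iff, loss_eq_true] using this
  unfold expErr
  simp_rw [hpt]
  rw [integral_div, integral_finsetSum _ fun r _ => (integrable_const _).indicator (hms r)]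
  congr 1
  refine Finset.sum_congr rfl fun r _ => ?_
  rw [integral_indicator_const _ (hms r), smul_eq_mul, mul_one, err]

/-- The infimum need not be attained, so the comparator comes with a slack `η`. -/
lemma exists_err_le_opt_add (D : Fin k → Measure (X × Bool)) {F : Set (X → Bool)}
    (hF : F.Nonempty) {η : ℝ} (hη : 0 < η) : ∃ f ∈ F, ∀ i, err (D i) f ≤ opt D F + η := by
  have : Nonempty F := hF.to_subtype
  obtain ⟨f, hf⟩ := exists_lt_of_ciInf_lt (show (⨅ f : F, ⨆ i, err (D i) f) < opt D F + η by
    unfold opt; linarith)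
  exact ⟨f, f.2, fun i => (le_ciSup (f := fun i => err (D i) f) (Set.finite_range _).bddAbove i).trans
    hf.le⟩

lemma HasVCDim.nonempty {Y : Type*} {F : Set (Y → Bool)} {d : ℕ} (hF : HasVCDim F d) :
    F.Nonempty := by
  obtain ⟨A, -, hA⟩ := hF.1
  obtain ⟨f, hf, -⟩ := hA fun _ => true
  exact ⟨f, hf⟩

/-- If two members differ at `x`, they realise both labels there, so `{x}` is shattered. -/
lemma HasVCDim.subsingleton {Y : Type*} {F : Set (Y → Bool)} (hF : HasVCDim F 0) :
    F.Subsingleton := by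
  intro f hf g hg
  funext x
  by_contra hne
  have : 1 ≤ 0 := hF.2 ⟨{x}, Finset.card_singleton x, fun h => by
    by_cases hx : f x = h x
    · exact ⟨f, hf, by simpa using hx⟩
    · refine ⟨g, hg, ?_⟩
      simp only [Finset.mem_singleton, forall_eq]
      cases hfx : f x <;> cases hgx : g x <;> cases hhx : h x <;> simp_all⟩
  omega

lemma opt_nonneg (D : Fin k → Measure (X × Bool)) (F : Set (X → Bool)) : 0 ≤ opt D F :=
  Real.iInf_nonneg fun f => Real.iSup_nonneg fun i => err_nonneg (D i) f

end Output

/-! ### Sample sizes and arithmetic of the constants. -/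

section Sizes

lemma log_two_le_log_natCast {k : ℕ} (hk : 2 ≤ k) : Real.log 2 ≤ Real.log k :=
  Real.log_le_log (by norm_num) (by exact_mod_cast hk)

lemma two_mul_le_rounds (k : ℕ) (ε α : ℝ) :
    2 * (Real.log k / (eps' ε * alpha' α ^ 2)) ≤ rounds k ε α := by
  have := Nat.le_ceil (Real.log k / (eps' ε * alpha' α ^ 2))
  unfold rounds
  push_cast
  linarith

lemma one_le_log_div {k : ℕ} (hk : 2 ≤ k) {ε α : ℝ} (hε : 0 < ε) (hε1 : ε < 1) (hα : 0 < α)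
    (hα1 : α < 1) : 1000 ≤ Real.log k / (eps' ε * alpha' α ^ 2) := by
  have hlog := (Real.log_two_gt_d9.le).trans (log_two_le_log_natCast hk)
  have hpos : 0 < eps' ε * alpha' α ^ 2 := by unfold eps' alpha'; positivity
  rw [le_div_iff₀ hpos]
  have h1 : eps' ε * alpha' α ^ 2 ≤ 1 / 25 * (1 / 12) ^ 2 := by
    unfold eps' alpha'
    gcongr
  linarith

lemma rounds_le {k : ℕ} (hk : 2 ≤ k) {ε α : ℝ} (hε : 0 < ε) (hε1 : ε < 1) (hα : 0 < α)
    (hα1 : α < 1) : (rounds k ε α : ℝ) ≤ 14400 * (Real.log k / (ε * α ^ 2)) := by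
  have h1 := one_le_log_div hk hε hε1 hα hα1
  have h2 := (Nat.ceil_lt_add_one (show 0 ≤ Real.log k / (eps' ε * alpha' α ^ 2) by linarith)).le
  have h3 : 4 * (Real.log k / (eps' ε * alpha' α ^ 2)) = 14400 * (Real.log k / (ε * α ^ 2)) := by
    unfold eps' alpha'
    field_simp
    ring
  unfold rounds
  push_cast
  linarith

lemma natCeil_le_two_mul {x : ℝ} (hx : 1 ≤ x) : (⌈x⌉₊ : ℝ) ≤ 2 * x := by
  have := (Nat.ceil_lt_add_one (show 0 ≤ x by linarith)).le
  linarith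

/-- The number of samples from the mixture in a round. -/
noncomputable def mixtureSize (k d : ℕ) (ε δ α : ℝ) : ℕ :=
  -- In dimension zero the class is a single function and no sample is needed. A positive size would
  -- leave a term `log (1 / ε)` inside `log (1 / delta')`, which the total count cannot absorb
  -- without the factor `d`.
  if d = 0 then 0 else
    ⌈48 * (1 / (alpha' α * eps' ε) *
      (d * Real.log (1 / eps' ε) + Real.log (1 / delta' k ε δ α)))⌉₊

/-- The number of samples from each player in a round. -/
noncomputable def playerSize (k : ℕ) (ε δ α : ℝ) : ℕ :=
  -- `δ` rather than `delta'`: the supermartingale treats all rounds together. This keeps `log (1 /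
  -- ε)` out of the term with the factor `k`.
  ⌈1 / (alpha' α * eps' ε) * Real.log (k / δ)⌉₊

variable {k d : ℕ} {ε δ α : ℝ}

lemma one_le_inv_alpha'_mul_eps' (hε : 0 < ε) (hε1 : ε < 1) (hα : 0 < α) (hα1 : α < 1) :
    300 ≤ 1 / (alpha' α * eps' ε) := by
  have hpos : 0 < alpha' α * eps' ε := by unfold eps' alpha'; positivity
  rw [le_div_iff₀ hpos]
  have : alpha' α * eps' ε ≤ 1 / 12 * (1 / 25) := by
    unfold eps' alpha'
    gcongr
  linarith

lemma one_le_log_inv_eps' (hε : 0 < ε) (hε1 : ε < 1) : 1 ≤ Real.log (1 / eps' ε) := by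
  rw [Real.le_log_iff_exp_le (by unfold eps'; positivity)]
  have h1 : (25 : ℝ) ≤ 1 / eps' ε := by
    unfold eps'
    rw [le_div_iff₀ (by positivity)]
    linarith
  linarith [Real.exp_one_lt_d9]

lemma delta'_pos (hk : 2 ≤ k) (hε : 0 < ε) (hε1 : ε < 1) (hδ : 0 < δ) (hα : 0 < α)
    (hα1 : α < 1) : 0 < delta' k ε δ α := by
  have h1 := one_le_log_div hk hε hε1 hα hα1
  have h2 := two_mul_le_rounds k ε α
  have : (0 : ℝ) < rounds k ε α := by linarith
  unfold delta'
  positivity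

lemma delta'_le (hk : 2 ≤ k) (hε : 0 < ε) (hε1 : ε < 1) (hδ : 0 < δ) (hα : 0 < α)
    (hα1 : α < 1) : delta' k ε δ α ≤ δ := by
  have h1 := one_le_log_div hk hε hε1 hα hα1
  have h2 := two_mul_le_rounds k ε α
  exact div_le_self hδ.le (by linarith)

lemma log_inv_delta'_nonneg (hk : 2 ≤ k) (hε : 0 < ε) (hε1 : ε < 1) (hδ : 0 < δ) (hδ1 : δ < 1)
    (hα : 0 < α) (hα1 : α < 1) : 0 ≤ Real.log (1 / delta' k ε δ α) :=
  Real.log_nonneg ((one_le_div (delta'_pos hk hε hε1 hδ hα hα1)).2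
    ((delta'_le hk hε hε1 hδ hα hα1).trans hδ1.le))

lemma mixtureSize_le (hk : 2 ≤ k) (hε : 0 < ε) (hε1 : ε < 1) (hδ : 0 < δ) (hδ1 : δ < 1)
    (hα : 0 < α) (hα1 : α < 1) : (mixtureSize k d ε δ α : ℝ) ≤
      96 * (1 / (alpha' α * eps' ε) *
        (d * Real.log (1 / eps' ε) + Real.log (1 / delta' k ε δ α))) := by
  have h1 := one_le_inv_alpha'_mul_eps' hε hε1 hα hα1
  have h2 := one_le_log_inv_eps' hε hε1
  have h3 := log_inv_delta'_nonneg hk hε hε1 hδ hδ1 hα hα1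
  unfold mixtureSize
  split_ifs with hd
  · rw [Nat.cast_zero]
    positivity
  · have hd1 : (1 : ℝ) ≤ d := by exact_mod_cast Nat.one_le_iff_ne_zero.2 hd
    have h4 : 1 ≤ d * Real.log (1 / eps' ε) + Real.log (1 / delta' k ε δ α) := by nlinarith
    refine (natCeil_le_two_mul ?_).trans (le_of_eq (by ring))
    nlinarith

lemma log_two_le_log_div (hk : 2 ≤ k) (hδ : 0 < δ) (hδ1 : δ < 1) :
    Real.log 2 ≤ Real.log (k / δ) := by
  refine Real.log_le_log (by norm_num) ?_
  rw [le_div_iff₀ hδ]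
  have : (2 : ℝ) ≤ k := by exact_mod_cast hk
  nlinarith

lemma playerSize_le (hk : 2 ≤ k) (hε : 0 < ε) (hε1 : ε < 1) (hδ : 0 < δ) (hδ1 : δ < 1)
    (hα : 0 < α) (hα1 : α < 1) : (playerSize k ε δ α : ℝ) ≤
      2 * (1 / (alpha' α * eps' ε) * Real.log (k / δ)) := by
  have h1 := one_le_inv_alpha'_mul_eps' hε hε1 hα hα1
  have h2 := (Real.log_two_gt_d9.le).trans (log_two_le_log_div hk hδ hδ1)
  refine natCeil_le_two_mul ?_
  nlinarith

/-- Here `1 / δ' = 4t / δ`, and `24ε / 25 < α` trades the powers of `1 / α` in `t` for powers of `1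
/ ε`, giving a bound of order `ε⁻³ * k / δ`. The `15` is `12` for the constant plus `3` for the
exponent. -/
lemma log_inv_delta'_le (hk : 2 ≤ k) (hε : 0 < ε) (hε1 : ε < 1) (hδ : 0 < δ)
    (hα : 24 * ε / 25 < α) (hα1 : α < 1) : Real.log (1 / delta' k ε δ α) ≤
      15 * max 1 (Real.log (1 / ε)) + Real.log (k / δ) := by
  have hα0 : 0 < α := by linarith
  have hk0 : (0 : ℝ) < k := by exact_mod_cast (show 0 < k by omega)
  have hr := rounds_le hk hε hε1 hα0 hα1
  have h1 := one_le_log_div hk hε hε1 hα0 hα1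
  have h2 := two_mul_le_rounds k ε α
  have hlogk : Real.log k ≤ k := (Real.log_le_sub_one_of_pos hk0).trans (by linarith)
  have hα2 : (24 * ε / 25) ^ 2 ≤ α ^ 2 := by gcongr
  have hbound : 1 / delta' k ε δ α ≤ 65000 * (1 / ε) ^ 3 * (k / δ) := by
    have e1 : 1 / delta' k ε δ α = 4 * rounds k ε α / δ := by
      unfold delta'
      rw [one_div_div]
    rw [e1, mul_div_assoc', div_le_div_iff_of_pos_right hδ]
    have h3 : Real.log k / (ε * α ^ 2) ≤ k / (ε * (24 * ε / 25) ^ 2) := by gcongr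
    have h4 : (k : ℝ) / (ε * (24 * ε / 25) ^ 2) = 625 / 576 * ((1 / ε) ^ 3 * k) := by
      field_simp
      norm_num
    have h5 : 0 ≤ (1 / ε) ^ 3 * (k : ℝ) := by positivity
    calc (4 * rounds k ε α : ℝ) ≤ 4 * (14400 * (625 / 576 * ((1 / ε) ^ 3 * k))) := by
          rw [← h4]; linarith
      _ ≤ 65000 * (1 / ε) ^ 3 * k := by linarith
  have hlog := Real.log_le_log (one_div_pos.2 (delta'_pos hk hε hε1 hδ hα0 hα1)) hbound
  rw [Real.log_mul (by positivity) (by positivity), Real.log_mul (by positivity) (by positivity),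
    Real.log_pow] at hlog
  have h12 : Real.log 65000 ≤ 12 := by
    rw [Real.log_le_iff_le_exp (by norm_num)]
    have : Real.exp 12 = Real.exp 1 ^ 12 := by rw [← Real.exp_nat_mul]; norm_num
    rw [this]
    calc (65000 : ℝ) ≤ 2.7 ^ 12 := by norm_num
      _ ≤ Real.exp 1 ^ 12 := by
        gcongr
        linarith [Real.exp_one_gt_d9]
  have m1 := le_max_left 1 (Real.log (1 / ε))
  have m2 := le_max_right 1 (Real.log (1 / ε))
  push_cast at hlog
  linarith

lemma log_inv_eps'_le (hε : 0 < ε) :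
    Real.log (1 / eps' ε) ≤ 5 * max 1 (Real.log (1 / ε)) := by
  have e1 : 1 / eps' ε = 25 * (1 / ε) := by unfold eps'; field_simp
  rw [e1, Real.log_mul (by norm_num) (by positivity)]
  have h4 : Real.log 25 ≤ 4 := by
    rw [Real.log_le_iff_le_exp (by norm_num)]
    have : Real.exp 4 = Real.exp 1 ^ 4 := by rw [← Real.exp_nat_mul]; norm_num
    rw [this]
    calc (25 : ℝ) ≤ 2.7 ^ 4 := by norm_num
      _ ≤ Real.exp 1 ^ 4 := by
        gcongr
        linarith [Real.exp_one_gt_d9]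
  have m1 := le_max_left 1 (Real.log (1 / ε))
  have m2 := le_max_right 1 (Real.log (1 / ε))
  linarith

lemma sampleCount_le (hk : 2 ≤ k) (hε : 0 < ε) (hε1 : ε < 1) (hδ : 0 < δ) (hδ1 : δ < 1)
    (hα : 24 * ε / 25 < α) (hα1 : α < 1) :
    (sampleCount k ε α (mixtureSize k d ε δ α) (playerSize k ε δ α) : ℝ) ≤
      10 ^ 10 * (Real.log k / (α ^ 3 * ε ^ 2) *
        (d * max 1 (Real.log (1 / ε)) + k * Real.log (k / δ))) := by
  have hα0 : 0 < α := by linarith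
  have hr := rounds_le hk hε hε1 hα0 hα1
  set mx := max 1 (Real.log (1 / ε)) with hmx
  have hmx1 : 1 ≤ mx := le_max_left _ _
  have hlog0 : 0 ≤ Real.log (k / δ) :=
    (Real.log_nonneg (by norm_num)).trans (log_two_le_log_div hk hδ hδ1)
  have hk1 : (1 : ℝ) ≤ k := by exact_mod_cast (show 1 ≤ k by omega)
  have hlogk : 0 ≤ Real.log k := Real.log_nonneg hk1
  have hinv : 1 / (alpha' α * eps' ε) = 300 * (1 / (α * ε)) := by
    unfold alpha' eps'
    field_simp
    norm_num
  -- The constants are `28800 = 96 * 300` and `20 = 5 + 15`, the latter from the two logarithms.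
  -- Absorbing the `15` uses `1 ≤ d`.
  have hS : (mixtureSize k d ε δ α : ℝ) ≤
      28800 * (1 / (α * ε)) * (20 * (d * mx) + k * Real.log (k / δ)) := by
    rcases Nat.eq_zero_or_pos d with rfl | hd
    · simp only [mixtureSize, if_true, Nat.cast_zero]
      positivity
    · have hd1 : (1 : ℝ) ≤ d := by exact_mod_cast hd
      refine (mixtureSize_le hk hε hε1 hδ hδ1 hα0 hα1).trans ?_
      rw [hinv]
      have h1 := log_inv_eps'_le hε
      have h2 := log_inv_delta'_le hk hε hε1 hδ hα hα1
      rw [← hmx] at h1 h2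
      have h3 : d * Real.log (1 / eps' ε) + Real.log (1 / delta' k ε δ α) ≤
          20 * (d * mx) + k * Real.log (k / δ) := by
        have h4 := mul_le_mul_of_nonneg_left h1 (show (0 : ℝ) ≤ d by positivity)
        nlinarith
      have h5 := mul_le_mul_of_nonneg_left h3 (show 0 ≤ 28800 * (1 / (α * ε)) by positivity)
      linarith
  have hT : (playerSize k ε δ α : ℝ) ≤ 600 * (1 / (α * ε)) * Real.log (k / δ) := by
    refine (playerSize_le hk hε hε1 hδ hδ1 hα0 hα1).trans (le_of_eq ?_)
    rw [hinv]
    ring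
  have hround : (mixtureSize k d ε δ α : ℝ) + k * playerSize k ε δ α ≤
      600000 * (1 / (α * ε)) * (d * mx + k * Real.log (k / δ)) := by
    have h1 := mul_le_mul_of_nonneg_left hT (show (0 : ℝ) ≤ k by positivity)
    have h2 : 0 ≤ 1 / (α * ε) * (d * mx) := by positivity
    have h3 : 0 ≤ 1 / (α * ε) * (k * Real.log (k / δ)) := by positivity
    nlinarith
  unfold sampleCount
  push_cast
  calc (rounds k ε α : ℝ) * (mixtureSize k d ε δ α + k * playerSize k ε δ α)
      ≤ 14400 * (Real.log k / (ε * α ^ 2)) *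
        (600000 * (1 / (α * ε)) * (d * mx + k * Real.log (k / δ))) := by gcongr
    _ = 8640000000 * (Real.log k / (α ^ 3 * ε ^ 2) * (d * mx + k * Real.log (k / δ))) := by
        field_simp
        ring
    _ ≤ _ := by
        have : 0 ≤ Real.log k / (α ^ 3 * ε ^ 2) * (d * mx + k * Real.log (k / δ)) := by positivity
        nlinarith

/-- The factor `48` in `mixtureSize` makes the exponent at least `4 * (d * L + M)`, with `L = log (1
/ eps')` and `M = log (1 / delta')`. The part `4 * d * L` pays for the growth function and the rest
is more than `M`. -/
lemma overfit_probability_le (hd : d ≠ 0) (hk : 2 ≤ k) (hε : 0 < ε) (hε1 : ε < 1) (hδ : 0 < δ)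
    (hδ1 : δ < 1) (hα : 24 * ε / 25 < α) (hα1 : α < 1) {mS : ℕ}
    (hmS : mixtureSize k d ε δ α ≤ mS) :
    (24 / (alpha' α * eps' ε)) ^ d * Real.exp (-(alpha' α * eps' ε / 12 * mS)) ≤
        delta' k ε δ α ∧
      Real.exp (-(alpha' α * eps' ε * mS)) ≤ delta' k ε δ α := by
  have hα0 : 0 < α := by linarith
  have hδ' := delta'_pos hk hε hε1 hδ hα0 hα1
  have hL := one_le_log_inv_eps' hε hε1
  have hM := log_inv_delta'_nonneg hk hε hε1 hδ hδ1 hα0 hα1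
  have hae : 0 < alpha' α * eps' ε := by unfold alpha' eps'; positivity
  have he : 0 < eps' ε := by unfold eps'; positivity
  set L := Real.log (1 / eps' ε) with hLdef
  set M := Real.log (1 / delta' k ε δ α) with hMdef
  have hexpM : Real.exp (-M) = delta' k ε δ α := by
    rw [hMdef, one_div, Real.log_inv, neg_neg, Real.exp_log hδ']
  have hsize : 48 * (d * L + M) ≤ alpha' α * eps' ε * mS := by
    have h1 : (mixtureSize k d ε δ α : ℝ) ≤ mS := by exact_mod_cast hmS
    rw [mixtureSize, if_neg hd] at h1
    have h2 := (Nat.le_ceil _).trans h1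
    have h3 := mul_le_mul_of_nonneg_left h2 hae.le
    refine le_trans (le_of_eq ?_) h3
    rw [← hLdef, ← hMdef, mul_left_comm, ← mul_assoc _ (1 / _), mul_one_div_cancel hae.ne', one_mul]
  have hd0 : (0 : ℝ) ≤ d * L := by positivity
  constructor
  · have h24 : Real.log (24 / (alpha' α * eps' ε)) ≤ 4 * L := by
      have : 24 / (alpha' α * eps' ε) ≤ (1 / eps' ε) ^ 4 := by
        -- This is exactly what `24ε / 25 < α` gives after rescaling.
        have h1 : 2 * eps' ε ≤ alpha' α := by unfold alpha' eps'; linarith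
        have h2 : eps' ε ≤ 1 / 25 := by unfold eps'; linarith
        rw [one_div, inv_pow, ← one_div, div_le_div_iff₀ hae (by positivity)]
        have h3 : eps' ε ^ 2 ≤ (1 / 25) ^ 2 := by gcongr
        have h4 : 24 * eps' ε ^ 4 ≤ 2 * eps' ε * eps' ε := by nlinarith [sq_nonneg (eps' ε)]
        nlinarith
      refine (Real.log_le_log (by positivity) this).trans (le_of_eq ?_)
      rw [Real.log_pow, ← hLdef]
      norm_num
    rw [← hexpM, ← Real.exp_log (show 0 < 24 / (alpha' α * eps' ε) by positivity),
      ← Real.exp_nat_mul, ← Real.exp_add, Real.exp_le_exp]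
    have h4 := mul_le_mul_of_nonneg_left h24 (Nat.cast_nonneg (α := ℝ) d)
    linarith
  · rw [← hexpM, Real.exp_le_exp]
    linarith

end Sizes

/-! ### From the potential to the error guarantee. -/

section Guarantee

variable {X : Type*} [MeasurableSpace X] {k d mS mT : ℕ} {ε δ α : ℝ}

/-- The deterministic part: the error is small if the rounds are good and the potential is. -/
lemma expErr_output_le (hk : 2 ≤ k) (hε : 0 < ε) (hε1 : ε < 1) (hδ : 0 < δ) (hδ1 : δ < 1)
    (hα : 0 < α) (hα1 : α < 1) (hmT : playerSize k ε δ α ≤ mT) (F : Set (X → Bool))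
    (D : Fin k → Measure (X × Bool)) [∀ i, IsProbabilityMeasure (D i)]
    {O : (Fin mS → X × Bool) → X → Bool} (hO : ∀ S, Measurable (O S)) (i : Fin k)
    {h : Fin (rounds k ε α) → Round X k mS mT}
    (hgood : AllRounds ε α O (GoodRound (alpha' α) (eps' ε)
      ((1 + alpha' α) * (opt D F + eps' ε) + 2 * eps' ε) D O) _ h)
    (hpot : mT / 2 * potential ε α D O i _ h <
      mT / 2 * Real.log k + Real.log (2 * k / δ)) :
    expErr (D i) (output O h) ≤ (1 + α) * opt D F + ε := by
  have hy := one_le_log_div hk hε hε1 hα hα1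
  have ht2 := two_mul_le_rounds k ε α
  have hinv := one_le_inv_alpha'_mul_eps' hε hε1 hα hα1
  have hlog2 := log_two_le_log_div hk hδ hδ1
  have hge := potential_ge hε hα D O i _ h
  have hopt := opt_nonneg D F
  have hα' : α = 12 * alpha' α := by unfold alpha'; ring
  have hε' : ε = 25 * eps' ε := by unfold eps'; ring
  have ha : 0 < alpha' α := by unfold alpha'; positivity
  have ha1 : alpha' α ≤ 1 / 12 := by unfold alpha'; linarith
  have he : 0 < eps' ε := by unfold eps'; positivity
  have hk0 : (0 : ℝ) < k := by exact_mod_cast (show 0 < k by omega)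
  generalize ht : rounds k ε α = t at *
  have ht0 : 0 < t := by
    have : (0 : ℝ) < t := by linarith
    exact_mod_cast this
  have htr : (0 : ℝ) < t := by exact_mod_cast ht0
  rw [expErr_output ht0 (D i) hO, div_le_iff₀ htr, hα', hε']
  set a := alpha' α with hadef
  set e := eps' ε with hedef
  set Q := ∑ j : Fin t, err (D i) (O (h j).1) / den a e (h j).1 (O (h j).1) with hQ
  set B := (1 + a) * (opt D F + e) + 2 * e with hB
  have hae : 0 < a * e := by positivity
  -- the potential bounds the normalized errors
  have hmTr : Real.log (k / δ) ≤ a * e * mT := by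
    have h1 : (playerSize k ε δ α : ℝ) ≤ mT := by exact_mod_cast hmT
    have h2 := mul_le_mul_of_nonneg_left ((Nat.le_ceil _).trans h1) hae.le
    refine le_trans (le_of_eq ?_) h2
    rw [← hadef, ← hedef]
    field_simp
  have hc : Real.log (2 * k / δ) ≤ 2 * Real.log (k / δ) := by
    rw [mul_div_assoc, Real.log_mul (by norm_num) (by positivity)]
    linarith
  have hlog2' := Real.log_two_gt_d9
  have hmT0 : (0 : ℝ) < mT := by
    by_contra hn
    have : (mT : ℝ) = 0 := le_antisymm (not_lt.1 hn) (Nat.cast_nonneg _)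
    rw [this] at hmTr
    linarith
  -- The deviation `log (2k / δ)` is at most `2 * log (k / δ) ≤ 2 * a * e * mT`; division by `mT /
  -- 2` leaves `4 * a * e`.
  have hpot' : potential ε α D O i t h < Real.log k + 4 * (a * e) := by
    have h1 : mT / 2 * potential ε α D O i t h < mT / 2 * (Real.log k + 4 * (a * e)) := by
      linarith
    exact lt_of_mul_lt_mul_left h1 (by positivity)
  have hlogk : Real.log k ≤ e * a * (a * t / 2) := by
    have h1 : Real.log k = Real.log k / (e * a ^ 2) * (e * a ^ 2) := by field_simp
    have h2 := mul_le_mul_of_nonneg_right ht2 (show 0 ≤ e * a ^ 2 by positivity)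
    linarith
  have hat : 400 ≤ a * t := by
    have h1 : 2 * Real.log k ≤ a * t * (a * e) := by
      have h2 := mul_le_mul_of_nonneg_right ht2 (show 0 ≤ e * a ^ 2 by positivity)
      have h3 : 2 * (Real.log k / (e * a ^ 2)) * (e * a ^ 2) = 2 * Real.log k := by field_simp
      linarith
    have h4 := log_two_le_log_natCast hk
    have h5 : a * e * 300 ≤ 1 := by
      rw [le_div_iff₀ hae] at hinv
      linarith
    by_contra hn
    have h6 := mul_le_mul_of_nonneg_right (not_le.1 hn).le hae.le
    linarith
  have hQle : (1 - a / 3) * Q - t ≤ a * t / 2 + 4 := by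
    have h1 : e * a * ((1 - a / 3) * Q - t) ≤ e * a * (a * t / 2 + 4) := by linarith
    exact le_of_mul_le_mul_left h1 (by positivity)
  -- As `(1 - a / 3) * (1 + a) = 1 + 2a/3 - a²/3`, there is room for `a * t / 2` and, because `a * t
  -- ≥ 400`, for the additive `4`.
  have hQt : Q ≤ t * (1 + a) := by
    have h1 : (1 - a / 3) * Q ≤ (1 - a / 3) * (t * (1 + a)) := by
      have h2 : a * (a * t) ≤ 1 / 12 * (a * t) := by gcongr
      nlinarith
    exact le_of_mul_le_mul_left h1 (by linarith)
  -- the normalization is bounded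
  have hden : ∀ j, den a e (h j).1 (O (h j).1) ≤ (1 + 3 * a) * B + 3 * e := by
    intro j
    obtain ⟨w, hw⟩ := hgood.exists_weights j
    unfold den
    have := mul_le_mul_of_nonneg_left hw.2 (show 0 ≤ 1 + 3 * a by positivity)
    linarith
  have hsum : ∑ j, err (D i) (O (h j).1) ≤ Q * ((1 + 3 * a) * B + 3 * e) := by
    rw [hQ, Finset.sum_mul]
    refine Finset.sum_le_sum fun j _ => ?_
    have hdp := den_pos ha he (h j).1 (O (h j).1)
    calc err (D i) (O (h j).1)
        = err (D i) (O (h j).1) / den a e (h j).1 (O (h j).1) *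
          den a e (h j).1 (O (h j).1) := by field_simp
      _ ≤ _ := mul_le_mul_of_nonneg_left (hden j) (div_nonneg (err_nonneg _ _) hdp.le)
  have hR : (1 + a) * ((1 + 3 * a) * B + 3 * e) ≤ (1 + 12 * a) * opt D F + 25 * e := by
    have h1 : (1 + a) * (1 + 3 * a) * (1 + a) ≤ 1 + 12 * a := by nlinarith [mul_pos ha ha]
    have h2 : (1 + a) * ((1 + 3 * a) * (3 + a) + 3) ≤ 25 := by nlinarith [mul_pos ha ha]
    have h3 := mul_le_mul_of_nonneg_right h1 hopt
    have h4 := mul_le_mul_of_nonneg_right h2 he.le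
    rw [hB]
    linarith
  have hB0 : 0 ≤ (1 + 3 * a) * B + 3 * e := by
    rw [hB]
    positivity
  have h1 := mul_le_mul_of_nonneg_right hQt hB0
  have h2 := mul_le_mul_of_nonneg_left hR htr.le
  linarith

/-- The guarantee for classes of positive VC dimension. -/
theorem law_expErr_output_ge (hd : d ≠ 0) (hk : 2 ≤ k) (hε : 0 < ε) (hε1 : ε < 1) (hδ : 0 < δ)
    (hδ1 : δ < 1) (hα : 24 * ε / 25 < α) (hα1 : α < 1) (hmS : mixtureSize k d ε δ α ≤ mS)
    (hmT : playerSize k ε δ α ≤ mT) {F : Set (X → Bool)} (hFm : ∀ f ∈ F, Measurable f)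
    (hF : HasVCDim F d) (D : Fin k → Measure (X × Bool)) [∀ i, IsProbabilityMeasure (D i)]
    {O : (Fin mS → X × Bool) → X → Bool} (hO : IsERM F (eps' ε) O) :
    ENNReal.ofReal (1 - δ) ≤ law (mT := mT) ε α D O (rounds k ε α)
      {h | ∀ i, expErr (D i) (output O h) ≤ (1 + α) * opt D F + ε} := by
  have hα0 : 0 < α := by linarith
  have hk0 : 0 < k := by omega
  have hkr : (0 : ℝ) < k := by exact_mod_cast hk0
  have he : 0 < eps' ε := by unfold eps'; positivity
  have he1 : eps' ε ≤ 1 := by unfold eps'; linarith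
  have ha : 0 < alpha' α := by unfold alpha'; positivity
  have ha1 : alpha' α ≤ 1 := by unfold alpha'; linarith
  have hδ' := delta'_pos hk hε hε1 hδ hα0 hα1
  have htr : (0 : ℝ) < rounds k ε α := by
    linarith [one_le_log_div hk hε hε1 hα0 hα1, two_mul_le_rounds k ε α]
  obtain ⟨hp1, hp2⟩ := overfit_probability_le hd hk hε hε1 hδ hδ1 hα hα1 hmS
  have hmS0 : 0 < mS := by
    refine Nat.pos_of_ne_zero fun h0 => ?_
    rw [h0, Nat.cast_zero, mul_zero, neg_zero, Real.exp_zero] at hp2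
    have hle : delta' k ε δ α ≤ δ := delta'_le hk hε hε1 hδ hα0 hα1
    linarith
  obtain ⟨f, hfF, hf⟩ := exists_err_le_opt_add D hF.nonempty he
  set good := GoodRound (alpha' α) (eps' ε)
      ((1 + alpha' α) * (opt D F + eps' ε) + 2 * eps' ε) D O with hgood
  -- Each round fails with probability at most `2 * δ'`, so all `t` rounds together cost `δ / 2`;
  -- the other half is shared by the `k` players.
  have hbadS := law_not_allRounds_le (mT := mT) (β := ENNReal.ofReal (2 * delta' k ε δ α)) D hk0 hε
    hα0 hO.measurable (measurableSet_goodRound D (alpha' α) (eps' ε)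
      ((1 + alpha' α) * (opt D F + eps' ε) + 2 * eps' ε) hO.measurable) (fun w hw => by
      refine (measure_not_goodRound_le D hk0 hmS0 hF ha ha1 he he1 hO hfF (hFm f hfF) hf hw).trans ?_
      rw [two_mul, ENNReal.ofReal_add hδ'.le hδ'.le]
      exact add_le_add (ENNReal.ofReal_le_ofReal hp1) (ENNReal.ofReal_le_ofReal hp2))
    (rounds k ε α)
  have hbadT := fun i => law_potential_ge_le (mT := mT) D hk0 hε hα0 hα1 hO.measurable
    ((1 + alpha' α) * (opt D F + eps' ε) + 2 * eps' ε) i (rounds k ε α) (Real.log (2 * k / δ))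
  have hexp : Real.exp (-Real.log (2 * k / δ)) = δ / (2 * k) := by
    rw [Real.exp_neg, Real.exp_log (by positivity), inv_div]
  rw [hexp] at hbadT
  have := isProbabilityMeasure_law (mT := mT) D hk0 hε hα0 hO.measurable (rounds k ε α)
  set μ := law (mT := mT) ε α D O (rounds k ε α) with hμ
  set A := {h : Fin (rounds k ε α) → Round X k mS mT |
    ∀ i, expErr (D i) (output O h) ≤ (1 + α) * opt D F + ε} with hA
  have hsub : Aᶜ ⊆ {h | ¬ AllRounds ε α O good (rounds k ε α) h} ∪ ⋃ i, {h |
      AllRounds ε α O good (rounds k ε α) h ∧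
        mT / 2 * Real.log k + Real.log (2 * k / δ) ≤
          mT / 2 * potential ε α D O i (rounds k ε α) h} := by
    intro h hh
    by_contra hn
    simp only [Set.mem_union, Set.mem_iUnion, Set.mem_ofPred_eq, not_or, not_not, not_exists,
      not_and, not_le] at hn
    exact hh fun i => expErr_output_le hk hε hε1 hδ hδ1 hα0 hα1 hmT F D
      (fun S => hFm _ (hO.mem S)) i hn.1 (hn.2 i hn.1)
  have hbad : μ Aᶜ ≤ ENNReal.ofReal δ := by
    calc μ Aᶜ ≤ rounds k ε α * ENNReal.ofReal (2 * delta' k ε δ α) +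
          ∑ _i : Fin k, ENNReal.ofReal (δ / (2 * k)) := by
          refine (measure_mono hsub).trans ((measure_union_le _ _).trans (add_le_add hbadS ?_))
          refine (measure_iUnion_le _).trans ?_
          rw [tsum_fintype]
          exact Finset.sum_le_sum fun i _ => hbadT i
      _ = ENNReal.ofReal δ := by
          rw [Finset.sum_const, Finset.card_univ, Fintype.card_fin, nsmul_eq_mul,
            ← ENNReal.ofReal_natCast, ← ENNReal.ofReal_natCast, ← ENNReal.ofReal_mul htr.le,
            ← ENNReal.ofReal_mul hkr.le, ← ENNReal.ofReal_add (by positivity) (by positivity)]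
          congr 1
          unfold delta'
          field_simp
          norm_num
  rw [ENNReal.ofReal_sub _ hδ.le, ENNReal.ofReal_one, tsub_le_iff_right]
  -- Subadditivity suffices, so the event `A` need not be shown measurable.
  calc (1 : ENNReal) = μ Set.univ := measure_univ.symm
    _ = μ (A ∪ Aᶜ) := by rw [Set.union_compl_self]
    _ ≤ μ A + μ Aᶜ := measure_union_le _ _
    _ ≤ μ A + ENNReal.ofReal δ := by gcongr

/-- The guarantee for classes with a single member. -/
theorem law_expErr_output_ge_of_vcDim_zero (hk : 2 ≤ k) (hε : 0 < ε) (hε1 : ε < 1) (hδ : 0 < δ)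
    (hα : 0 < α) (hα1 : α < 1) {F : Set (X → Bool)} (hFm : ∀ f ∈ F, Measurable f)
    (hF : HasVCDim F 0) (D : Fin k → Measure (X × Bool)) [∀ i, IsProbabilityMeasure (D i)]
    {O : (Fin mS → X × Bool) → X → Bool} (hO : IsERM F (eps' ε) O) :
    ENNReal.ofReal (1 - δ) ≤ law (mT := mT) ε α D O (rounds k ε α)
      {h | ∀ i, expErr (D i) (output O h) ≤ (1 + α) * opt D F + ε} := by
  have htr : (0 : ℝ) < rounds k ε α := by
    linarith [one_le_log_div hk hε hε1 hα hα1, two_mul_le_rounds k ε α]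
  have ht : 0 < rounds k ε α := by exact_mod_cast htr
  have := isProbabilityMeasure_law (mT := mT) D (by omega) hε hα hO.measurable (rounds k ε α)
  have huniv : {h : Fin (rounds k ε α) → Round X k mS mT |
      ∀ i, expErr (D i) (output O h) ≤ (1 + α) * opt D F + ε} = Set.univ := by
    refine Set.eq_univ_of_forall fun h i => ?_
    obtain ⟨f, hfF, hf⟩ := exists_err_le_opt_add D hF.nonempty hε
    have hopt := opt_nonneg D F
    have hOf : ∀ S, O S = f := fun S => hF.subsingleton (hO.mem S) hfF
    rw [expErr_output ht (D i) fun S => hFm _ (hO.mem S), div_le_iff₀ htr]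
    simp only [hOf, Finset.sum_const, Finset.card_univ, Fintype.card_fin, nsmul_eq_mul]
    rw [mul_comm]
    refine mul_le_mul_of_nonneg_right ((hf i).trans ?_) htr.le
    nlinarith
  rw [huniv, measure_univ, ← ENNReal.ofReal_one]
  exact ENNReal.ofReal_le_ofReal (by linarith)

end Guarantee

end CollabPAC

open CollabPAC in
theorem theorem5 :
    ∃ (C : ℝ) (nS : ℕ → ℕ → ℝ → ℝ → ℝ → ℕ) (nT : ℕ → ℝ → ℝ → ℝ → ℕ), 0 < C ∧
      ∀ (k d : ℕ) (ε δ α : ℝ), 2 ≤ k → 0 < ε → ε < 1 → 0 < δ → δ < 1 →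
        24 * ε / 25 < α → α < 1 →
        -- the sample sizes of a round
        (nS k d ε δ α : ℝ) ≤ C * (1 / (alpha' α * eps' ε) *
          (d * Real.log (1 / eps' ε) + Real.log (1 / delta' k ε δ α))) ∧
        (nT k ε δ α : ℝ) ≤ C * (1 / (alpha' α * eps' ε) * Real.log (k / delta' k ε δ α)) ∧
        -- the total number of samples
        (sampleCount k ε α (nS k d ε δ α) (nT k ε δ α) : ℝ) ≤
          C * (Real.log k / (α ^ 3 * ε ^ 2) *
            (d * max 1 (Real.log (1 / ε)) + k * Real.log (k / δ))) ∧
        -- the error guarantee, for these sample sizes and for all larger ones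
        ∀ mS mT : ℕ, nS k d ε δ α ≤ mS → nT k ε δ α ≤ mT →
          ∀ (X : Type*) [MeasurableSpace X] (F : Set (X → Bool)),
            IsMeasurableClass F → HasVCDim F d →
            ∀ D : Fin k → Measure (X × Bool), (∀ i, IsProbabilityMeasure (D i)) →
              ∀ O : (Fin mS → X × Bool) → X → Bool, IsERM F (eps' ε) O →
                ENNReal.ofReal (1 - δ) ≤
                  law (mT := mT) ε α D O (rounds k ε α)
                    {h | ∀ i, expErr (D i) (output O h) ≤ (1 + α) * opt D F + ε} := by
  -- The constant is dictated by the total count in `sampleCount_le`; the two sizes need only `96`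
  -- and `2`.
  refine ⟨10 ^ 10, mixtureSize, playerSize, by norm_num, ?_⟩
  intro k d ε δ α hk hε hε1 hδ hδ1 hα hα1
  have hα0 : 0 < α := by linarith
  have hδ' := delta'_pos hk hε hε1 hδ hα0 hα1
  have hinv := one_le_inv_alpha'_mul_eps' hε hε1 hα0 hα1
  refine ⟨?_, ?_, sampleCount_le hk hε hε1 hδ hδ1 hα hα1, ?_⟩
  · refine (mixtureSize_le hk hε hε1 hδ hδ1 hα0 hα1).trans ?_
    have hL := one_le_log_inv_eps' hε hε1
    have hM := log_inv_delta'_nonneg hk hε hε1 hδ hδ1 hα0 hα1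
    exact mul_le_mul_of_nonneg_right (by norm_num) (by positivity)
  · refine (playerSize_le hk hε hε1 hδ hδ1 hα0 hα1).trans ?_
    have hk0 : (0 : ℝ) < k := by exact_mod_cast (show 0 < k by omega)
    have hlog0 : 0 ≤ Real.log (k / δ) :=
      (Real.log_nonneg (by norm_num)).trans (log_two_le_log_div hk hδ hδ1)
    have hle : Real.log (k / δ) ≤ Real.log (k / delta' k ε δ α) := by
      refine Real.log_le_log (by positivity) ?_
      have := delta'_le hk hε hε1 hδ hα0 hα1
      gcongr
    refine mul_le_mul (by norm_num) ?_ (by positivity) (by norm_num)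
    exact mul_le_mul_of_nonneg_left hle (by positivity)
  · intro mS mT hmS hmT X _ F hFm hF D hD O hO
    rcases eq_or_ne d 0 with rfl | hd
    · exact law_expErr_output_ge_of_vcDim_zero hk hε hε1 hδ hα0 hα1 hFm.measurable_of_mem hF D hO
    · exact law_expErr_output_ge hd hk hε hε1 hδ hδ1 hα hα1 hmS hmT hFm.measurable_of_mem hF D hO
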